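/- Let $G_0$ be a finite union of smooth domains in $\mathbb R^2$ whose closures are pairwise disjoint and contained in the open unit square $\square=(0,1)^2$. Put $Y=\overline{\square}\setminus\overline{G_0}$, let $|Y|$ be its Lebesgue measure and $\langle f\rangle_Y=|Y|^{-1}\int_Y f\,d\xi$, and assume that $Y$ is symmetric with respect to the lines $\xi_1=\frac12$ and $\xi_2=\frac12$. Let $\nu=(\nu_1,\nu_2)$ be the unit normal to $\partial G_0$ (and, extended periodically, to its integer translates) that is external to $Y$. Let $N_1$ be a solution of the cell problem, that is, a function on the union of the integer translates of $\overline{\square}\setminus G_0$, smooth up to the boundaries of the holes, $1$-periodic in $\xi_1$ and $\xi_2$, with $$\Delta_\xi N_1=0\ \text{ in } Y,\qquad \partial_\nu N_1=-\nu_1\ \text{ on }\partial G_0,\qquad \langle N_1\rangle_Y=0,$$ and let $h_{11}=\langle 1+\partial_{\xi_1}N_1\rangle_Y$ and $\gamma=\{\xi:\ \xi_1=0,\ 0<\xi_2<1\}$. Call $J\in\mathbb R$ a flux constant if for some $q\in\mathbb R$ the inner-layer problem has a solution: there are functions $B^-$ on $\{\xi_1\le 0\}$ and $B^+$ on the part of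 the periodically perforated plane in $\{\xi_1\ge 0\}$, smooth up to the boundary and $1$-periodic in $\xi_2$, such that $\Delta_\xi B^\pm=0$ in the interior, $\partial_\nu B^+=0$ on the boundaries of the holes, $B^\pm(\xi)\to0$ as $\xi_1\to\pm\infty$ uniformly in $\xi_2$, and on $\gamma$ $$B^+-B^-=q,\qquad \partial_{\xi_1}B^+-\partial_{\xi_1}B^-=-(\partial_{\xi_1}N_1+1)+J .$$ Then every flux constant is equal to $$J_1:=\int_\gamma(\partial_{\xi_1}N_1+1)\big|_{\xi_1=0}\,d\xi_2 ,\qquad\text{and}\qquad J_1=|Y|\,h_{11}.$$ Hence, for every $d>0$ and all functions $v_0^-,v_0^+$, the transmission condition $\partial_{x_1}v_0^-=J_1\,\partial_{x_1}v_0^+$ on $\{x_1=0,\ 0<x_2<d\}$ (with the derivatives taken from the left and from the right, respectively, and required to exist) is equivalent to the homogenized coupling condition $\partial_{x_1}v_0^-=|Y|\,h_{11}\,\partial_{x_1}v_0^+$ there. -/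

import Mathlib

open MeasureTheory Set
open scoped ContDiff Gradient Laplacian

noncomputable section

/-- The Euclidean plane. The coordinates `ξ₁, ξ₂` of a point `ξ` are `ξ 0` and `ξ 1`. -/
abbrev Plane : Type := EuclideanSpace ℝ (Fin 2)

/-- The integer vector `k`, as a point of the plane. -/
def latticePoint (k : Fin 2 → ℤ) : Plane := WithLp.toLp 2 fun i => (k i : ℝ)

/-- The open unit square. -/
def openSquare : Set Plane := {ξ | ∀ i, ξ i ∈ Ioo (0 : ℝ) 1}

/-- The closed unit square. -/
def closedSquare : Set Plane := {ξ | ∀ i, ξ i ∈ Icc (0 : ℝ) 1}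

/-- `φ` is a smooth defining function of `D` near the boundary point `x`:
near `x` the set `D` is `{φ < 0}`, and `∇φ(x) ≠ 0`. -/
structure IsLocalDefiningFunction (D : Set Plane) (x : Plane) (φ : Plane → ℝ) : Prop where
  smooth : ContDiff ℝ ∞ φ
  zero : φ x = 0
  gradient_ne : ∇ φ x ≠ 0
  mem_iff : ∀ᶠ y in nhds x, (y ∈ D ↔ φ y < 0)

/-- A smooth domain: nonempty, open, connected, with smooth boundary. -/
structure IsSmoothDomain (D : Set Plane) : Prop where
  isOpen : IsOpen D
  isConnected : IsConnected D
  smooth_boundary : ∀ x ∈ frontier D, ∃ φ, IsLocalDefiningFunction D x φ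

/-- `ν` is the unit normal at `x ∈ ∂G₀` that points into `G₀`, i.e. out of the perforated
region. -/
def IsUnitNormalInto (G₀ : Set Plane) (x ν : Plane) : Prop :=
  ∃ φ, IsLocalDefiningFunction G₀ x φ ∧ ν = -(‖∇ φ x‖⁻¹ • ∇ φ x)

/-- The periodicity cell `Y`: the closed unit square without the closure of the holes. -/
def cellY (G₀ : Set Plane) : Set Plane := closedSquare \ closure G₀

/-- Reflection with respect to the line `ξ_l = 1/2`. -/
def midReflect (l : Fin 2) (ξ : Plane) : Plane :=
  WithLp.toLp 2 (Function.update ξ.ofLp l (1 - ξ l))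

/-- The holes `G₀`: a finite union of smooth domains that do not meet or touch each other and
whose closures lie in the open unit square, such that `Y` is symmetric with respect to the lines
`ξ₁ = 1/2` and `ξ₂ = 1/2`. -/
def IsHoleSet (G₀ : Set Plane) : Prop :=
  (∃ (n : ℕ) (G : Fin n → Set Plane),
    G₀ = (⋃ i, G i) ∧
    (∀ i, IsSmoothDomain (G i)) ∧
    (∀ i, closure (G i) ⊆ openSquare) ∧
    Pairwise fun i j => Disjoint (closure (G i)) (closure (G j))) ∧
  ∀ l, ∀ ξ ∈ cellY G₀, midReflect l ξ ∈ cellY G₀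

/-- The periodically perforated plane with the boundaries of the holes included (a closed set). -/
def perfPlane (G₀ : Set Plane) : Set Plane := {ξ | ∀ k, ξ - latticePoint k ∉ G₀}

/-- The periodically perforated plane without the boundaries of the holes: the union of all integer
translates of `Y` (an open set). -/
def perfPlaneInt (G₀ : Set Plane) : Set Plane := {ξ | ∀ k, ξ - latticePoint k ∉ closure G₀}

/-- The partial derivative `∂_{ξ_{i+1}} f (ξ)` of a function on `s`; at points of `s` on the
boundary it is the boundary value. -/
def partialIn (s : Set Plane) (f : Plane → ℝ) (i : Fin 2) (ξ : Plane) : ℝ :=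
  fderivWithin ℝ f s ξ (EuclideanSpace.single i 1)

/-- `N` is a solution `N₁` of the first cell problem: smooth up to the boundaries of the holes and
`1`-periodic in both variables (so that it belongs to `H¹_per(Y)`), with `Δ N = 0` in `Y`,
`∂_ν N = -ν₁` on `∂G₀`, and mean value zero over `Y`. -/
structure IsCellSolution (G₀ : Set Plane) (N : Plane → ℝ) : Prop where
  smooth : ContDiffOn ℝ ∞ N (perfPlane G₀)
  periodic : ∀ k, ∀ ξ ∈ perfPlane G₀, N (ξ + latticePoint k) = N ξ
  laplace : ∀ ξ ∈ perfPlaneInt G₀, Δ N ξ = 0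
  neumann : ∀ ξ ∈ frontier G₀, ∀ ν, IsUnitNormalInto G₀ ξ ν →
    fderivWithin ℝ N (perfPlane G₀) ξ ν = -(ν 0)
  mean_zero : ⨍ ξ in cellY G₀, N ξ = 0

/-- The homogenized coefficient `h₁₁ = ⟨1 + ∂_{ξ₁} N₁⟩_Y`. -/
def h11 (G₀ : Set Plane) (N₁ : Plane → ℝ) : ℝ :=
  ⨍ ξ in cellY G₀, (1 + partialIn (perfPlane G₀) N₁ 0 ξ)

/-- The integral of `∂_{ξ₁} N₁ + 1` over `γ = {ξ₁ = 0, 0 < ξ₂ < 1}`. -/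
def interfaceFlux (G₀ : Set Plane) (N₁ : Plane → ℝ) : ℝ :=
  ∫ t in (0 : ℝ)..1, (partialIn (perfPlane G₀) N₁ 0 !₂[0, t] + 1)

/-- The closed left half-plane (the periodic extension of the semi-strip `Υ⁻`). -/
def leftHalf : Set Plane := {ξ | ξ 0 ≤ 0}

/-- The closed perforated right half-plane (the periodic extension of the perforated semi-strip
`Υ⁺`, with the boundaries of the holes included). -/
def rightHalf (G₀ : Set Plane) : Set Plane := {ξ | 0 ≤ ξ 0 ∧ ξ ∈ perfPlane G₀}

/-- `B⁻ = Bm`, `B⁺ = Bp` solve the inner-layer problem for `B₁` with the constants `J` and `q`: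
both functions are smooth up to the boundary, `1`-periodic in `ξ₂`, harmonic and vanish as
`ξ₁ → ∓∞`; `B⁺` has zero normal derivative on the boundaries of the holes; and across `γ`
the jump of `B` is `q` and the jump of `∂_{ξ₁} B` is `-(∂_{ξ₁} N₁ + 1) + J`. -/
structure IsInnerLayerSolution (G₀ : Set Plane) (N₁ : Plane → ℝ) (J q : ℝ)
    (Bm Bp : Plane → ℝ) : Prop where
  smooth_left : ContDiffOn ℝ ∞ Bm leftHalf
  smooth_right : ContDiffOn ℝ ∞ Bp (rightHalf G₀)
  periodic_left : ∀ ξ ∈ leftHalf, Bm (ξ + latticePoint ![0, 1]) = Bm ξ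
  periodic_right : ∀ ξ ∈ rightHalf G₀, Bp (ξ + latticePoint ![0, 1]) = Bp ξ
  laplace_left : ∀ ξ : Plane, ξ 0 < 0 → Δ Bm ξ = 0
  laplace_right : ∀ ξ ∈ perfPlaneInt G₀, 0 < ξ 0 → Δ Bp ξ = 0
  neumann : ∀ k : Fin 2 → ℤ, 0 ≤ k 0 → ∀ ξ ∈ frontier G₀, ∀ ν, IsUnitNormalInto G₀ ξ ν →
    fderivWithin ℝ Bp (rightHalf G₀) (ξ + latticePoint k) ν = 0
  jump : ∀ t ∈ Ioo (0 : ℝ) 1, Bp !₂[0, t] - Bm !₂[0, t] = q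
  jump_deriv : ∀ t ∈ Ioo (0 : ℝ) 1,
    partialIn (rightHalf G₀) Bp 0 !₂[0, t] - partialIn leftHalf Bm 0 !₂[0, t] =
      -(partialIn (perfPlane G₀) N₁ 0 !₂[0, t] + 1) + J
  decay_left : ∀ ε > 0, ∃ M : ℝ, ∀ ξ ∈ leftHalf, ξ 0 ≤ -M → |Bm ξ| < ε
  decay_right : ∀ ε > 0, ∃ M : ℝ, ∀ ξ ∈ rightHalf G₀, M ≤ ξ 0 → |Bp ξ| < ε

/-- `J` is a flux constant: a constant for which the inner-layer problem for `B₁` is solvable. -/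
def IsFluxConstant (G₀ : Set Plane) (N₁ : Plane → ℝ) (J : ℝ) : Prop :=
  ∃ (q : ℝ) (Bm Bp : Plane → ℝ), IsInnerLayerSolution G₀ N₁ J q Bm Bp

/-- The transmission condition `∂_{x₁} v⁻ = κ ∂_{x₁} v⁺` on `Z = {x₁ = 0, 0 < x₂ < d}`, where the
derivatives of `v⁻` and `v⁺` are taken from the left and from the right (and exist). -/
def TransmissionCondition (d κ : ℝ) (vm vp : Plane → ℝ) : Prop :=
  ∀ t ∈ Ioo 0 d, ∃ a b : ℝ,
    HasDerivWithinAt (fun s : ℝ => vm !₂[s, t]) a (Iic 0) 0 ∧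
    HasDerivWithinAt (fun s : ℝ => vp !₂[s, t]) b (Ici 0) 0 ∧
    a = κ * b

end

/-! Both parts are flux computations for fields that are divergence-free and tangential to the
boundaries of the holes. For such a field `F`, Green's formula `∫_Y ∇ψ · F = ∫_{∂□} ψ F · n` sees
only the outer boundary of the cell; it is proved without traces on curved boundaries, by cutting
test functions off near the holes and using that `F · ∇φ` vanishes to first order on `∂G₀` for
every defining function `φ`. With `ψ = 1` the fluxes of `F` through `ξ₁ = 0` and `ξ₁ = 1` agree,
and with `ψ = ξ₁` their common value is `∫_Y F₁`; the field `F = ∇N₁ + e₁` gives `J₁ = |Y| h₁₁`.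
The flux of `∇B⁺` through `ξ₁ = n` does not depend on `n`, while in a vertical strip without holes
the identity `div (ξ₁ ∇B - B e₁) = ξ₁ ΔB` expresses the flux by mean values of `B` on vertical
segments, which tend to `0`. So the fluxes of `∇B⁺` and `∇B⁻` through `γ` vanish, and `J = J₁` is
the integral of the jump condition over `γ`. -/

noncomputable section

open Filter
open scoped Manifold InnerProductSpace Pointwise Topology

section Divergence

variable {E : Type*} [NormedAddCommGroup E] [NormedSpace ℝ E]

/-- The divergence of a vector field, defined without coordinates as the trace of its
derivative. -/
def divergence (F : E → E) (x : E) : ℝ := LinearMap.trace ℝ E (fderiv ℝ F x)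

lemma divergence_eq_sum {ι : Type*} [Fintype ι] (b : Module.Basis ι ℝ E) {F : E → E} {x : E} :
    divergence F x = ∑ i, b.coord i (fderiv ℝ F x (b i)) := by
  classical
  rw [divergence, LinearMap.trace_eq_matrix_trace ℝ b, Matrix.trace]
  simp [LinearMap.toMatrix_apply]

lemma divergence_const (v : E) (x : E) : divergence (fun _ => v) x = 0 := by
  simp [divergence]

lemma divergence_add {F H : E → E} {x : E} (hF : DifferentiableAt ℝ F x)
    (hH : DifferentiableAt ℝ H x) :
    divergence (fun y => F y + H y) x = divergence F x + divergence H x := by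
  rw [divergence, fderiv_fun_add hF hH, ContinuousLinearMap.toLinearMap_add, map_add]
  rfl

variable [FiniteDimensional ℝ E]

lemma divergence_smul {g : E → ℝ} {F : E → E} {x : E} (hg : DifferentiableAt ℝ g x)
    (hF : DifferentiableAt ℝ F x) :
    divergence (fun y => g y • F y) x = g x * divergence F x + fderiv ℝ g x (F x) := by
  rw [divergence, fderiv_fun_smul hg hF]
  simp only [ContinuousLinearMap.toLinearMap_add, ContinuousLinearMap.toLinearMap_smul, map_add,
    map_smul, smul_eq_mul]
  congr 1
  exact LinearMap.trace_smulRight (fderiv ℝ g x : E →ₗ[ℝ] ℝ) (F x)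

variable [MeasurableSpace E] [BorelSpace E] {μ : Measure E} [μ.IsAddHaarMeasure]

lemma integral_fderiv_eq_zero {g : E → ℝ} (hg : ContDiff ℝ 1 g) (hc : HasCompactSupport g)
    (v : E) : ∫ x, fderiv ℝ g x v ∂μ = 0 := by
  have hcont : Continuous fun x => fderiv ℝ g x v :=
    (hg.continuous_fderiv one_ne_zero).clm_apply continuous_const
  simpa using integral_mul_fderiv_eq_neg_fderiv_mul_of_integrable (μ := μ) (f := fun _ => (1 : ℝ))
    (g := g) (v := v) (by simp)
    (by simpa using hcont.integrable_of_hasCompactSupport (hc.fderiv_apply ℝ v))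
    (by simpa using hg.continuous.integrable_of_hasCompactSupport hc)
    (fun _ _ => by fun_prop) (fun x _ => hg.contDiffAt.differentiableAt one_ne_zero)

lemma integral_divergence_eq_zero {F : E → E} (hF : ContDiff ℝ 1 F) (hc : HasCompactSupport F) :
    ∫ x, divergence F x ∂μ = 0 := by
  let b := Module.finBasis ℝ E
  let coord i : E →L[ℝ] ℝ := LinearMap.toContinuousLinearMap (b.coord i)
  have hcoord i : ContDiff ℝ 1 fun x => coord i (F x) := (coord i).contDiff.comp hF
  have hsupp i : HasCompactSupport fun x => coord i (F x) := hc.comp_left (map_zero _)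
  have hdiv x : divergence F x = ∑ i, fderiv ℝ (fun x => coord i (F x)) x (b i) := by
    rw [divergence_eq_sum b]
    refine Finset.sum_congr rfl fun i _ => ?_
    have h := (coord i).hasFDerivAt.comp x (hF.differentiable one_ne_zero x).hasFDerivAt
    exact (DFunLike.congr_fun h.fderiv (b i)).symm
  simp_rw [hdiv]
  rw [integral_finsetSum]
  · exact Finset.sum_eq_zero fun i _ => integral_fderiv_eq_zero (hcoord i) (hsupp i) _
  · exact fun i _ => (((hcoord i).continuous_fderiv one_ne_zero).clm_apply
      continuous_const).integrable_of_hasCompactSupport ((hsupp i).fderiv_apply ℝ _)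

lemma setIntegral_fderiv_apply_eq_zero {U : Set E} (hU : IsOpen U) {F : E → E}
    (hF : ContDiffOn ℝ 1 F U) (hdiv : ∀ x ∈ U, divergence F x = 0) {ψ : E → ℝ}
    (hψ : ContDiff ℝ 1 ψ) (hc : HasCompactSupport ψ) (hψU : tsupport ψ ⊆ U) :
    ∫ x in U, fderiv ℝ ψ x (F x) ∂μ = 0 := by
  have hzero {x} (hx : x ∉ tsupport ψ) : ψ =ᶠ[𝓝 x] 0 := notMem_tsupport_iff_eventuallyEq.1 hx
  have hFat {x} (hx : x ∈ tsupport ψ) : ContDiffAt ℝ 1 F x :=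
    hF.contDiffAt (hU.mem_nhds (hψU hx))
  have hzero' {x} (hx : x ∉ tsupport ψ) : (fun y => ψ y • F y) =ᶠ[𝓝 x] fun _ => 0 :=
    (hzero hx).mono fun y hy => by simp [hy]
  have hψF : ContDiff ℝ 1 fun x => ψ x • F x := by
    refine contDiff_iff_contDiffAt.2 fun x => ?_
    by_cases hx : x ∈ tsupport ψ
    · exact hψ.contDiffAt.smul (hFat hx)
    · exact contDiffAt_const.congr_of_eventuallyEq (hzero' hx)
  have hdivψ x : divergence (fun y => ψ y • F y) x = fderiv ℝ ψ x (F x) := by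
    by_cases hx : x ∈ tsupport ψ
    · rw [divergence_smul (hψ.differentiable one_ne_zero x)
        ((hFat hx).differentiableAt one_ne_zero), hdiv x (hψU hx), mul_zero, zero_add]
    · rw [divergence, (hzero' hx).fderiv_eq, (hzero hx).fderiv_eq]
      simp
  rw [setIntegral_eq_integral_of_forall_compl_eq_zero]
  · simpa only [hdivψ] using integral_divergence_eq_zero (μ := μ) hψF hc.smul_right
  · intro x hx
    rw [(hzero fun h => hx (hψU h)).fderiv_eq]
    simp

end Divergence

section BoundaryVanishing

variable {E : Type*} [NormedAddCommGroup E] [NormedSpace ℝ E]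

lemma map_sub_smul_le_of_le_fderiv {φ : E → ℝ} (hφ : Differentiable ℝ φ) {y e : E} {c T : ℝ}
    (h : ∀ s ∈ Icc 0 T, c ≤ fderiv ℝ φ (y - s • e) e) {s t : ℝ} (hs : s ∈ Icc 0 T)
    (ht : t ∈ Icc 0 T) (hst : s ≤ t) : φ (y - t • e) ≤ φ (y - s • e) - c * (t - s) := by
  have hline (r : ℝ) : HasDerivAt (fun r : ℝ => φ (y - r • e)) (-fderiv ℝ φ (y - r • e) e) r := by
    have hsub : HasDerivAt (fun r : ℝ => y - r • e) (-e) r := by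
      simpa using ((hasDerivAt_id r).smul_const e).const_sub y
    simpa [Function.comp_def] using (hφ (y - r • e)).hasFDerivAt.comp_hasDerivAt r hsub
  have hle := (convex_Icc 0 T).image_sub_le_mul_sub_of_deriv_le
    (f := fun r : ℝ => φ (y - r • e)) (C := -c)
    (fun r _ => (hline r).continuousAt.continuousWithinAt)
    (fun r _ => (hline r).differentiableAt.differentiableWithinAt)
    (fun r hr => by
      rw [(hline r).deriv]
      exact neg_le_neg (h r (interior_subset hr))) s hs t ht hst
  linarith

lemma exists_pos_eventually_forall_sub_smul {p : E → Prop} {x : E} (hp : ∀ᶠ y in 𝓝 x, p y)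
    (e : E) : ∃ T > 0, ∀ᶠ y in 𝓝 x, ∀ s ∈ Icc (0 : ℝ) T, p (y - s • e) := by
  have hlim : Tendsto (fun z : E × ℝ => z.1 - z.2 • e) (𝓝 x ×ˢ 𝓝 0) (𝓝 x) := by
    have : Continuous fun z : E × ℝ => z.1 - z.2 • e := by fun_prop
    simpa [nhds_prod_eq] using this.tendsto (x, 0)
  obtain ⟨q, hq, r, hr, hqr⟩ := eventually_prod_iff.1 (hlim.eventually hp)
  obtain ⟨T, hT, hTr⟩ := Metric.nhds_basis_closedBall.eventually_iff.1 hr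
  refine ⟨T, hT, hq.mono fun y hy s hs => hqr hy (hTr ?_)⟩
  rw [Metric.mem_closedBall, Real.dist_0_eq_abs, abs_of_nonneg hs.1]
  exact hs.2

lemma exists_descent_to_zero {φ : E → ℝ} (hφ : ContDiff ℝ 1 φ) {x e : E} (hx : φ x = 0)
    (he : 0 < fderiv ℝ φ x e) {V : Set E} (hV : V ∈ 𝓝 x) :
    ∃ c > 0, ∀ᶠ y in 𝓝 x, 0 < φ y → ∃ t ≥ 0, c * t ≤ φ y ∧ φ (y - t • e) = 0 ∧
      ∀ s ∈ Icc 0 t, y - s • e ∈ V ∧ 0 ≤ φ (y - s • e) := by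
  obtain ⟨c, hc, hce⟩ := exists_between he
  have hslope : ∀ᶠ y in 𝓝 x, c ≤ fderiv ℝ φ y e :=
    (((hφ.continuous_fderiv one_ne_zero).clm_apply
      continuous_const).continuousAt.eventually_const_lt hce).mono fun _ => le_of_lt
  obtain ⟨T, hT, hnear⟩ := exists_pos_eventually_forall_sub_smul (hslope.and hV) e
  have hsmall : ∀ᶠ y in 𝓝 x, φ y < c * T :=
    hφ.continuous.continuousAt.eventually_lt_const (by rw [hx]; positivity)
  refine ⟨c, hc, ?_⟩
  filter_upwards [hnear, hsmall] with y hy hyT hpos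
  have hdecr {s t : ℝ} (hs : s ∈ Icc 0 T) (ht : t ∈ Icc 0 T) (hst : s ≤ t) :=
    map_sub_smul_le_of_le_fderiv (hφ.differentiable one_ne_zero) (fun r hr => (hy r hr).1) hs ht hst
  have h0 : (0 : ℝ) ∈ Icc 0 T := ⟨le_rfl, hT.le⟩
  have hT0 : φ (y - T • e) ≤ 0 := by
    have := hdecr h0 ⟨hT.le, le_rfl⟩ hT.le
    simp only [zero_smul, sub_zero] at this
    linarith
  obtain ⟨t, ht, ht0⟩ : ∃ t ∈ Icc 0 T, φ (y - t • e) = 0 :=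
    intermediate_value_Icc' hT.le (hφ.continuous.comp (by fun_prop)).continuousOn
      ⟨hT0, by simpa using hpos.le⟩
  refine ⟨t, ht.1, ?_, ht0, fun s hs => ?_⟩
  · have := hdecr h0 ht ht.1
    simp only [zero_smul, sub_zero] at this
    linarith
  · have hsT : s ∈ Icc 0 T := ⟨hs.1, hs.2.trans ht.2⟩
    have hst : 0 ≤ c * (t - s) := mul_nonneg hc.le (sub_nonneg.2 hs.2)
    exact ⟨(hy s hsT).2, by linarith [hdecr hsT ht hs.2]⟩

lemma exists_fderiv_pos {φ : E → ℝ} {x : E} (h : fderiv ℝ φ x ≠ 0) : ∃ e, 0 < fderiv ℝ φ x e := by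
  obtain ⟨v, hv⟩ := DFunLike.ne_iff.1 h
  rcases lt_or_gt_of_ne hv with hneg | hpos
  · exact ⟨-v, by simpa using hneg⟩
  · exact ⟨v, hpos⟩

lemma exists_abs_le_mul_of_eq_zero {S : Set E} (hS : UniqueDiffOn ℝ S) {φ g : E → ℝ}
    (hφ : ContDiff ℝ 1 φ) {x : E} (hxS : x ∈ S) (hx : φ x = 0) (hd : fderiv ℝ φ x ≠ 0)
    (hmem : ∀ᶠ y in 𝓝 x, 0 ≤ φ y → y ∈ S) (hg : ContDiffOn ℝ 1 g S)
    (hg0 : ∀ᶠ y in 𝓝 x, φ y = 0 → g y = 0) :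
    ∃ C, ∀ᶠ y in 𝓝 x, 0 < φ y → |g y| ≤ C * φ y := by
  obtain ⟨e, he⟩ := exists_fderiv_pos hd
  set K := ‖fderivWithin ℝ g S x‖ + 1
  have hbound : ∀ᶠ y in 𝓝 x, y ∈ S → ‖fderivWithin ℝ g S y‖ < K :=
    eventually_nhdsWithin_iff.1
      ((hg.continuousOn_fderivWithin hS le_rfl x hxS).norm.eventually_lt_const (lt_add_one _))
  obtain ⟨c, hc, hdesc⟩ := exists_descent_to_zero hφ hx he (hmem.and (hbound.and hg0))
  refine ⟨K * ‖e‖ / c, hdesc.mono fun y hy hpos => ?_⟩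
  obtain ⟨t, ht, hct, hφt, hpath⟩ := hy hpos
  have hpathS : ∀ s ∈ Icc 0 t, y - s • e ∈ S := fun s hs => (hpath s hs).1.1 (hpath s hs).2
  have hderiv : ∀ s ∈ Icc 0 t, HasDerivWithinAt (fun s : ℝ => g (y - s • e))
      (fderivWithin ℝ g S (y - s • e) (-e)) (Icc 0 t) s := fun s hs =>
    (hg.differentiableOn one_ne_zero _ (hpathS s hs)).hasFDerivWithinAt.comp_hasDerivWithinAt s
      (by simpa using (((hasDerivAt_id s).smul_const e).const_sub y).hasDerivWithinAt) hpathS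
  have hmvt := norm_image_sub_le_of_norm_deriv_le_segment' hderiv (C := K * ‖e‖) (fun s hs => by
    have hs' := Ico_subset_Icc_self hs
    rw [map_neg, norm_neg]
    exact (fderivWithin ℝ g S (y - s • e)).le_of_opNorm_le
      ((hpath s hs').1.2.1 (hpathS s hs')).le e) t ⟨ht, le_rfl⟩
  rw [(hpath t ⟨ht, le_rfl⟩).1.2.2 hφt] at hmvt
  simp only [zero_smul, sub_zero, zero_sub, norm_neg, Real.norm_eq_abs] at hmvt
  calc |g y| ≤ K * ‖e‖ * t := hmvt
    _ ≤ K * ‖e‖ * (φ y / c) := by gcongr; exact (le_div_iff₀' hc).2 hct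
    _ = K * ‖e‖ / c * φ y := by ring

end BoundaryVanishing

section WeakForm

variable {E : Type*} [NormedAddCommGroup E] [NormedSpace ℝ E]

lemma exists_cutoff : ∃ η : ℝ → ℝ, ContDiff ℝ 1 η ∧ (∀ t ≤ 1, η t = 0) ∧ (∀ t, 2 ≤ t → η t = 1) ∧
    (∀ t, |η t| ≤ 1) ∧ ∃ K, ∀ t, |t * deriv η t| ≤ K := by
  let η : ℝ → ℝ := fun t => Real.smoothTransition (t - 1)
  have hη : ContDiff ℝ 1 η := Real.smoothTransition.contDiff.comp (contDiff_id.sub contDiff_const)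
  have h0 : ∀ t ≤ 1, η t = 0 := fun t ht => Real.smoothTransition.zero_of_nonpos (by linarith)
  have h1 (t : ℝ) (ht : 2 ≤ t) : η t = 1 := Real.smoothTransition.one_of_one_le (by linarith)
  refine ⟨η, hη, h0, h1, fun t => ?_, ?_⟩
  · rw [abs_of_nonneg (Real.smoothTransition.nonneg _)]
    exact Real.smoothTransition.le_one _
  · have hsupp : HasCompactSupport (deriv η) := by
      refine HasCompactSupport.intro (isCompact_Icc (a := 1) (b := 2)) fun t ht => ?_
      rw [mem_Icc, not_and_or, not_le, not_le] at ht
      rcases ht with ht | ht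
      · have : η =ᶠ[𝓝 t] fun _ => 0 :=
          mem_of_superset (Iio_mem_nhds ht) fun s hs => h0 s (le_of_lt hs)
        rw [this.deriv_eq, deriv_const]
      · have : η =ᶠ[𝓝 t] fun _ => 1 :=
          mem_of_superset (Ioi_mem_nhds ht) fun s hs => h1 s (le_of_lt hs)
        rw [this.deriv_eq, deriv_const]
    exact (continuous_id.mul (hη.continuous_deriv le_rfl)).bounded_above_of_compact_support
      hsupp.mul_left

lemma tendsto_cutoff_mul_add {η : ℝ → ℝ} (hη : ∀ t, 2 ≤ t → η t = 1) {r : ℝ} (hr : 0 < r)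
    (a b : ℝ) : Tendsto (fun n : ℕ => η ((n + 1) * r) * a + (n + 1) * deriv η ((n + 1) * r) * b)
      atTop (𝓝 a) := by
  have hbig : ∀ᶠ n : ℕ in atTop, 2 < (n + 1 : ℝ) * r :=
    ((tendsto_natCast_atTop_atTop.atTop_add tendsto_const_nhds).atTop_mul_const
      hr).eventually_gt_atTop 2
  refine tendsto_const_nhds.congr' (hbig.mono fun n hn => ?_)
  have : η =ᶠ[𝓝 ((n + 1 : ℝ) * r)] fun _ => 1 :=
    mem_of_superset (Ioi_mem_nhds hn) fun s hs => hη s (le_of_lt hs)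
  simp [this.deriv_eq, hη _ hn.le]

lemma abs_mul_deriv_cutoff_mul_le {η : ℝ → ℝ} {K : ℝ} (hK : ∀ t, |t * deriv η t| ≤ K) {C a t : ℝ}
    (ht : 0 < t) (ha : |a| ≤ C * t) (r : ℝ) : |r * deriv η (r * t) * a| ≤ |C| * K := by
  calc |r * deriv η (r * t) * a| = |r * deriv η (r * t)| * |a| := abs_mul _ _
    _ ≤ |r * deriv η (r * t)| * (|C| * t) := by
      gcongr
      exact ha.trans (by gcongr; exact le_abs_self C)
    _ = |C| * |r * t * deriv η (r * t)| := by
      rw [abs_mul, abs_mul, abs_mul, abs_of_pos ht]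
      ring
    _ ≤ |C| * K := by gcongr; exact hK _

lemma fderiv_cutoff_mul_apply {η : ℝ → ℝ} (hη : Differentiable ℝ η) {φ ψ : E → ℝ}
    (hφ : Differentiable ℝ φ) (hψ : Differentiable ℝ ψ) (r : ℝ) (y v : E) :
    fderiv ℝ (fun z => η (r * φ z) * ψ z) y v =
      η (r * φ y) * fderiv ℝ ψ y v + r * deriv η (r * φ y) * (ψ y * fderiv ℝ φ y v) := by
  have hηφ := (hη (r * φ y)).hasDerivAt.comp_hasFDerivAt y ((hφ y).hasFDerivAt.const_mul r)
  refine (DFunLike.congr_fun (hηφ.mul (hψ y).hasFDerivAt).fderiv v).trans ?_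
  simp
  ring

lemma abs_fderiv_cutoff_mul_apply_le {η : ℝ → ℝ} (hη : Differentiable ℝ η) (hη1 : ∀ t, |η t| ≤ 1)
    {K : ℝ} (hK : ∀ t, |t * deriv η t| ≤ K) {φ ψ : E → ℝ} (hφ : Differentiable ℝ φ)
    (hψ : Differentiable ℝ ψ) {C : ℝ} {y v : E} (hy : 0 < φ y)
    (hv : |fderiv ℝ φ y v| ≤ C * φ y) (r : ℝ) :
    |fderiv ℝ (fun z => η (r * φ z) * ψ z) y v| ≤ |fderiv ℝ ψ y v| + |C| * K * |ψ y| := by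
  rw [fderiv_cutoff_mul_apply hη hφ hψ, mul_left_comm]
  refine (abs_add_le _ _).trans ?_
  rw [abs_mul, abs_mul (ψ y), mul_comm (|C| * K)]
  gcongr
  · exact mul_le_of_le_one_left (abs_nonneg _) (hη1 _)
  · exact abs_mul_deriv_cutoff_mul_le hK hy hv r

lemma mem_tsupport_and_pos_of_mem_tsupport_cutoff_mul {X : Type*} [TopologicalSpace X] {η : ℝ → ℝ}
    (hη : ∀ t ≤ 1, η t = 0) {φ ψ : X → ℝ} (hφ : Continuous φ) {r : ℝ} (hr : 0 ≤ r) {y : X}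
    (hy : y ∈ tsupport fun z => η (r * φ z) * ψ z) : y ∈ tsupport ψ ∧ 0 < φ y := by
  have hclosed : IsClosed {z | 1 ≤ r * φ z} :=
    isClosed_le continuous_const (continuous_const.mul hφ)
  have hsub : Function.support (fun z => η (r * φ z)) ⊆ {z | 1 ≤ r * φ z} :=
    fun z hz => le_of_lt (not_le.1 fun h => hz (hη _ h))
  have hone : 1 ≤ r * φ y := closure_minimal hsub hclosed (tsupport_mul_subset_left hy)
  exact ⟨tsupport_mul_subset_right hy, pos_of_mul_pos_right (one_pos.trans_le hone) hr⟩

variable [FiniteDimensional ℝ E]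

lemma exists_sum_eq_of_mem_nhds {ψ : E → ℝ} (hψ : ContDiff ℝ ∞ ψ) (hc : HasCompactSupport ψ)
    {W : E → Set E} (hW : ∀ x ∈ tsupport ψ, W x ∈ 𝓝 x) :
    ∃ (s : Finset (tsupport ψ)) (f : tsupport ψ → E → ℝ), (∀ x, ContDiff ℝ ∞ (f x) ∧
      HasCompactSupport (f x) ∧ tsupport (f x) ⊆ W x) ∧ ψ = ∑ x ∈ s, f x := by
  obtain ⟨ρ, hρ⟩ := SmoothPartitionOfUnity.exists_isSubordinate 𝓘(ℝ, E)
    (isClosed_tsupport ψ) (fun x : tsupport ψ => interior (W x)) (fun _ => isOpen_interior)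
    (fun x hx => mem_iUnion.2 ⟨⟨x, hx⟩, mem_interior_iff_mem_nhds.2 (hW x hx)⟩)
  have hfin := ρ.locallyFinite.finite_nonempty_inter_compact hc.isCompact
  refine ⟨hfin.toFinset, fun x y => ρ x y * ψ y, fun x => ⟨(ρ x).contMDiff.contDiff.mul hψ,
    hc.mul_left, tsupport_mul_subset_left.trans ((hρ x).trans interior_subset)⟩, ?_⟩
  funext y
  rw [Finset.sum_apply, ← Finset.sum_mul]
  by_cases hy : y ∈ tsupport ψ
  · have hone := ρ.sum_eq_one hy
    rw [finsum_eq_sum_of_support_subset (s := hfin.toFinset) _ fun x hx => by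
      rw [Finite.coe_toFinset]
      exact ⟨y, hx, hy⟩] at hone
    rw [hone, one_mul]
  · simp [image_eq_zero_of_notMem_tsupport hy]

variable [MeasurableSpace E] {μ : Measure E}

lemma setIntegral_fderiv_apply_eq_zero_of_locally {U : Set E} {F : E → E} {ψ : E → ℝ}
    (hψ : ContDiff ℝ ∞ ψ) (hc : HasCompactSupport ψ)
    (hint : ∀ f : E → ℝ, ContDiff ℝ ∞ f → IntegrableOn (fun y => fderiv ℝ f y (F y)) U μ)
    (hloc : ∀ x ∈ tsupport ψ, ∃ W ∈ 𝓝 x, ∀ f : E → ℝ, ContDiff ℝ ∞ f → HasCompactSupport f →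
      tsupport f ⊆ W → ∫ y in U, fderiv ℝ f y (F y) ∂μ = 0) :
    ∫ y in U, fderiv ℝ ψ y (F y) ∂μ = 0 := by
  choose! W hW hWzero using hloc
  obtain ⟨s, f, hf, hsum⟩ := exists_sum_eq_of_mem_nhds hψ hc hW
  have hderiv y : fderiv ℝ ψ y (F y) = ∑ x ∈ s, fderiv ℝ (f x) y (F y) := by
    conv_lhs => rw [hsum, fderiv_sum fun x _ => (hf x).1.differentiable (by simp) y]
    simp
  simp_rw [hderiv]
  rw [integral_finsetSum _ fun x _ => hint _ (hf x).1]
  exact Finset.sum_eq_zero fun x _ => hWzero x x.2 _ (hf x).1 (hf x).2.1 (hf x).2.2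

variable [BorelSpace E] [μ.IsAddHaarMeasure]

/-- The test function need not vanish on the boundary `{φ = 0}`: cutting it off at distance of
order `1 / n` costs nothing in the limit, because the field is tangential there. -/
lemma setIntegral_fderiv_apply_eq_zero_of_tangential {U : Set E} (hU : IsOpen U) {F : E → E}
    (hF : ContDiffOn ℝ 1 F U) (hdiv : ∀ x ∈ U, divergence F x = 0) {φ ψ : E → ℝ}
    (hφ : ContDiff ℝ 1 φ) {C : ℝ} (hψ : ContDiff ℝ 1 ψ) (hc : HasCompactSupport ψ)
    (hmem : ∀ y ∈ tsupport ψ, y ∈ U ↔ 0 < φ y)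
    (htan : ∀ y ∈ tsupport ψ, 0 < φ y → |fderiv ℝ φ y (F y)| ≤ C * φ y)
    (hint : IntegrableOn (fun y => fderiv ℝ ψ y (F y)) U μ) :
    ∫ y in U, fderiv ℝ ψ y (F y) ∂μ = 0 := by
  obtain ⟨η, hη, hη0, hη1, hηb, K, hK⟩ := exists_cutoff
  have hηd := hη.differentiable one_ne_zero
  have hφd := hφ.differentiable one_ne_zero
  have hψd := hψ.differentiable one_ne_zero
  let χψ : ℕ → E → ℝ := fun n y => η ((n + 1) * φ y) * ψ y
  have hχψ n : ContDiff ℝ 1 (χψ n) := (hη.comp (contDiff_const.mul hφ)).mul hψ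
  have hvanish n y (hy : y ∉ tsupport ψ) : fderiv ℝ (χψ n) y = 0 :=
    fderiv_of_notMem_tsupport ℝ fun h => hy (tsupport_mul_subset_right h)
  have hcut n : ∫ y in U, fderiv ℝ (χψ n) y (F y) ∂μ = 0 := by
    refine setIntegral_fderiv_apply_eq_zero hU hF hdiv (hχψ n) hc.mul_left fun y hy => ?_
    have := mem_tsupport_and_pos_of_mem_tsupport_cutoff_mul hη0 hφ.continuous (by positivity) hy
    exact (hmem y this.1).2 this.2
  have hbound (n : ℕ) : ∀ᵐ y ∂μ.restrict U,
      ‖fderiv ℝ (χψ n) y (F y)‖ ≤ |fderiv ℝ ψ y (F y)| + |C| * K * |ψ y| := by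
    refine (ae_restrict_mem hU.measurableSet).mono fun y hyU => ?_
    by_cases hy : y ∈ tsupport ψ
    · have hpos := (hmem y hy).1 hyU
      exact abs_fderiv_cutoff_mul_apply_le hηd hηb hK hφd hψd hpos (htan y hy hpos) _
    · simp [hvanish n y hy, fderiv_of_notMem_tsupport ℝ hy, image_eq_zero_of_notMem_tsupport hy]
  have hlim : ∀ᵐ y ∂μ.restrict U, Tendsto (fun n => fderiv ℝ (χψ n) y (F y)) atTop
      (𝓝 (fderiv ℝ ψ y (F y))) := by
    refine (ae_restrict_mem hU.measurableSet).mono fun y hyU => ?_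
    by_cases hy : y ∈ tsupport ψ
    · simp_rw [χψ, fderiv_cutoff_mul_apply hηd hφd hψd]
      exact tendsto_cutoff_mul_add hη1 ((hmem y hy).1 hyU) _ _
    · simp [hvanish _ y hy, fderiv_of_notMem_tsupport ℝ hy]
  have hdom := tendsto_integral_of_dominated_convergence _
    (fun n => (((hχψ n).continuous_fderiv one_ne_zero).continuousOn.clm_apply
      hF.continuousOn).aestronglyMeasurable hU.measurableSet)
    (hint.abs.add ((hψ.continuous.integrable_of_hasCompactSupport hc).abs.integrableOn.const_mul _))
    hbound hlim
  simp_rw [hcut] at hdom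
  exact tendsto_nhds_unique hdom tendsto_const_nhds

end WeakForm

section Gradient

variable {E : Type*} [NormedAddCommGroup E] [InnerProductSpace ℝ E] [FiniteDimensional ℝ E]
  {Ω S : Set E} {u : E → ℝ}

lemma contDiffOn_gradientWithin (hS : UniqueDiffOn ℝ S) (hSΩ : S ⊆ Ω) (hu : ContDiffOn ℝ 2 u Ω) :
    ContDiffOn ℝ 1 (gradientWithin u Ω) S := by
  let b := stdOrthonormalBasis ℝ E
  have hderiv : ContDiffOn ℝ 1 (fderivWithin ℝ u Ω) S :=
    ((hu.mono hSΩ).fderivWithin hS (by norm_num)).congr fun x hx =>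
      (fderivWithin_subset hSΩ (hS x hx) (hu.differentiableOn two_ne_zero x (hSΩ hx))).symm
  have hsum : ContDiffOn ℝ 1 (fun x => ∑ i, fderivWithin ℝ u Ω x (b i) • b i) S :=
    ContDiffOn.sum fun i _ => (hderiv.clm_apply contDiffOn_const).smul contDiffOn_const
  refine hsum.congr fun x _ => ?_
  have hcoef i : fderivWithin ℝ u Ω x (b i) = ⟪b i, gradientWithin u Ω x⟫_ℝ := by
    rw [inner_gradientWithin_right, conj_trivial]
  simp_rw [hcoef]
  exact (b.sum_repr' _).symm

lemma divergence_gradientWithin {x : E} (hΩ : Ω ∈ 𝓝 x) (hu : ContDiffOn ℝ 2 u Ω) :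
    divergence (gradientWithin u Ω) x = Δ u x := by
  let b := stdOrthonormalBasis ℝ E
  have hux : ContDiffAt ℝ 2 u x := hu.contDiffAt hΩ
  have hgrad : gradientWithin u Ω =ᶠ[𝓝 x] ∇ u :=
    (eventually_mem_nhds_iff.2 hΩ).mono fun y hy => by
      rw [gradientWithin, gradient, fderivWithin_of_mem_nhds hy]
  have hderiv : DifferentiableAt ℝ (fderiv ℝ u) x :=
    (hux.fderiv_right (m := 1) (by norm_num)).differentiableAt one_ne_zero
  have hgradx : DifferentiableAt ℝ (∇ u) x := by
    refine DifferentiableAt.congr_of_eventuallyEq ?_ hgrad.symm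
    obtain ⟨S, hSΩ, hS, hxS⟩ := mem_nhds_iff.1 hΩ
    exact (((contDiffOn_gradientWithin hS.uniqueDiffOn hSΩ hu).contDiffAt
      (hS.mem_nhds hxS)).differentiableAt one_ne_zero)
  rw [divergence, hgrad.fderiv_eq, LinearMap.trace_eq_sum_inner _ b,
    InnerProductSpace.laplacian_eq_iteratedFDeriv_orthonormalBasis u b]
  refine Finset.sum_congr rfl fun i _ => ?_
  have hinner : (fun y => ⟪b i, ∇ u y⟫_ℝ) = fun y => fderiv ℝ u y (b i) := by
    funext y
    rw [inner_gradient_right, conj_trivial]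
  have hcomp := (innerSL ℝ (b i)).hasFDerivAt.comp x hgradx.hasFDerivAt
  rw [iteratedFDeriv_two_apply]
  calc ⟪b i, fderiv ℝ (∇ u) x (b i)⟫_ℝ = fderiv ℝ (fun y => ⟪b i, ∇ u y⟫_ℝ) x (b i) :=
        (DFunLike.congr_fun hcomp.fderiv (b i)).symm
    _ = fderiv ℝ (fderiv ℝ u) x (b i) (b i) := by
        rw [hinner, fderiv_clm_apply hderiv (by fun_prop)]
        simp

end Gradient

section Translation

variable {E : Type*} [NormedAddCommGroup E] [NormedSpace ℝ E] {Ω : Set E} {u : E → ℝ} {x : E}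

lemma fderivWithin_comp_add (Ω : Set E) (u : E → ℝ) (a x : E) :
    fderivWithin ℝ (fun y => u (y + a)) {y | y + a ∈ Ω} x = fderivWithin ℝ u Ω (x + a) := by
  rw [fderivWithin_comp_add_right]
  congr
  ext y
  simp [mem_vadd_set_iff_neg_vadd_mem]

lemma fderivWithin_add_of_periodic {e : E} (hΩ : ∀ y, y + e ∈ Ω ↔ y ∈ Ω)
    (hu : ∀ y ∈ Ω, u (y + e) = u y) (hx : x ∈ Ω) :
    fderivWithin ℝ u Ω (x + e) = fderivWithin ℝ u Ω x := by
  rw [← fderivWithin_comp_add, (Set.ext hΩ : {y | y + e ∈ Ω} = Ω)]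
  exact fderivWithin_congr hu (hu x hx)

end Translation

lemma gradientWithin_apply (u : Plane → ℝ) (Ω : Set Plane) (ξ : Plane) (i : Fin 2) :
    gradientWithin u Ω ξ i = partialIn Ω u i ξ := by
  rw [partialIn, ← inner_gradientWithin_left, EuclideanSpace.inner_single_right]
  simp

section Box

/-- The rectangle `[a, b] × [0, 1]`. -/
def periodBox (a b : ℝ) : Set Plane := {ξ | ξ 0 ∈ Icc a b ∧ ξ 1 ∈ Icc (0 : ℝ) 1}

/-- The linear identification of `ℝ × ℝ` with the Euclidean plane, which transports the divergence
theorem from a product of intervals to `periodBox`. -/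
def prodPlane : (ℝ × ℝ) ≃L[ℝ] Plane :=
  (ContinuousLinearEquiv.finTwoArrow ℝ ℝ).symm.trans (EuclideanSpace.equiv (Fin 2) ℝ).symm

lemma prodPlane_apply (p : ℝ × ℝ) : prodPlane p = !₂[p.1, p.2] := rfl

lemma measurePreserving_prodPlane : MeasurePreserving prodPlane :=
  (PiLp.volume_preserving_toLp (Fin 2)).comp (volume_preserving_finTwoArrow ℝ).symm

variable {a b : ℝ}

lemma preimage_prodPlane_periodBox (a b : ℝ) :
    prodPlane ⁻¹' periodBox a b = Icc (a, 0) (b, 1) := (Icc_prod_Icc a b 0 1)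

lemma isCompact_periodBox (a b : ℝ) : IsCompact (periodBox a b) :=
  prodPlane.symm.toHomeomorph.isCompact_preimage.2 (isCompact_Icc.prod isCompact_Icc)

lemma convex_periodBox (a b : ℝ) : Convex ℝ (periodBox a b) :=
  (((convex_Icc a b).prod (convex_Icc 0 1)).is_linear_preimage
    prodPlane.symm.toLinearEquiv.toLinearMap.isLinear :)

lemma interior_periodBox (a b : ℝ) :
    interior (periodBox a b) = {ξ : Plane | ξ 0 ∈ Ioo a b ∧ ξ 1 ∈ Ioo (0 : ℝ) 1} := by
  have h := prodPlane.symm.toHomeomorph.preimage_interior (Icc a b ×ˢ Icc 0 1)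
  rw [interior_prod_eq, interior_Icc, interior_Icc] at h
  exact h.symm

lemma uniqueDiffOn_periodBox (hab : a < b) : UniqueDiffOn ℝ (periodBox a b) := by
  refine uniqueDiffOn_convex (convex_periodBox a b) ⟨!₂[(a + b) / 2, 1 / 2], ?_⟩
  rw [interior_periodBox]
  constructor <;> constructor <;> simp <;> linarith

lemma ae_restrict_periodBox_mem_interior (a b : ℝ) :
    ∀ᵐ ξ ∂volume.restrict (periodBox a b), ξ ∈ interior (periodBox a b) := by
  have hfrontier : ∀ᵐ ξ : Plane, ξ ∉ frontier (periodBox a b) :=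
    measure_eq_zero_iff_ae_notMem.1 ((convex_periodBox a b).addHaar_frontier volume)
  filter_upwards [ae_restrict_of_ae hfrontier,
    ae_restrict_mem (isCompact_periodBox a b).measurableSet] with ξ hξ hmem
  exact by_contra fun h => hξ ⟨subset_closure hmem, h⟩

lemma continuous_vertical (x : ℝ) : Continuous fun y : ℝ => (!₂[x, y] : Plane) :=
  prodPlane.continuous.comp (Continuous.prodMk_right x)

/-- The mean value of `f` over the vertical unit segment `{x} × (0, 1)`. -/
def verticalMean (f : Plane → ℝ) (x : ℝ) : ℝ := ∫ y in (0 : ℝ)..1, f !₂[x, y]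

lemma intervalIntegrable_vertical {S : Set Plane} {f : Plane → ℝ} (hf : ContinuousOn f S) {x : ℝ}
    (hx : ∀ y ∈ Icc (0 : ℝ) 1, !₂[x, y] ∈ S) :
    IntervalIntegrable (fun y => f !₂[x, y]) volume 0 1 := by
  refine (hf.comp (continuous_vertical x).continuousOn fun y hy => ?_).intervalIntegrable
  rw [uIcc_of_le zero_le_one] at hy
  exact hx y hy

/-- The flux of the vector field `F` out of the rectangle `[a, b] × [0, 1]`. -/
def outwardFlux (a b : ℝ) (F : Plane → Plane) : ℝ :=
  verticalMean (fun ξ => F ξ 0) b - verticalMean (fun ξ => F ξ 0) a +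
    ((∫ x in a..b, F !₂[x, 1] 1) - ∫ x in a..b, F !₂[x, 0] 1)

lemma outwardFlux_of_periodic (hab : a ≤ b) {F : Plane → Plane}
    (hF : ∀ x ∈ Icc a b, F !₂[x, 1] 1 = F !₂[x, 0] 1) :
    outwardFlux a b F = verticalMean (fun ξ => F ξ 0) b - verticalMean (fun ξ => F ξ 0) a := by
  rw [outwardFlux, intervalIntegral.integral_congr (g := fun x => F !₂[x, 0] 1), sub_self, add_zero]
  rwa [uIcc_of_le hab]

lemma divergence_eq_sum_single (F : Plane → Plane) (ξ : Plane) :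
    divergence F ξ = ∑ i, fderiv ℝ F ξ (EuclideanSpace.single i 1) i := by
  simp [divergence_eq_sum (EuclideanSpace.basisFun (Fin 2) ℝ).toBasis]

lemma setIntegral_sum_fderivWithin_periodBox (hab : a < b) {F : Plane → Plane}
    (hF : ContDiffOn ℝ 1 F (periodBox a b)) :
    ∫ ξ in periodBox a b, ∑ i, fderivWithin ℝ F (periodBox a b) ξ (EuclideanSpace.single i 1) i =
      outwardFlux a b F := by
  let D (i : Fin 2) (ξ : Plane) : Plane →L[ℝ] ℝ :=
    (EuclideanSpace.proj i).comp (fderivWithin ℝ F (periodBox a b) ξ)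
  let D' (i : Fin 2) (p : ℝ × ℝ) : ℝ × ℝ →L[ℝ] ℝ :=
    (D i (prodPlane p)).comp (prodPlane : ℝ × ℝ →L[ℝ] Plane)
  have hmaps : MapsTo prodPlane (Icc (a, 0) (b, 1)) (periodBox a b) := by
    rw [← preimage_prodPlane_periodBox]
    exact mapsTo_preimage _ _
  have hcont i : ContinuousOn (fun p => F (prodPlane p) i) (Icc (a, 0) (b, 1)) :=
    (EuclideanSpace.proj (𝕜 := ℝ) i).continuous.comp_continuousOn
      (hF.continuousOn.comp prodPlane.continuous.continuousOn hmaps)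
  have hderiv i : ∀ p ∈ Ioo a b ×ˢ Ioo (0 : ℝ) 1,
      HasFDerivAt (fun p => F (prodPlane p) i) (D' i p) p := by
    intro p hp
    have hint : prodPlane p ∈ interior (periodBox a b) := by rwa [interior_periodBox]
    have hFp := ((hF.differentiableOn one_ne_zero _ (interior_subset hint)).hasFDerivWithinAt
      ).hasFDerivAt (mem_interior_iff_mem_nhds.1 hint)
    exact ((EuclideanSpace.proj (𝕜 := ℝ) i).hasFDerivAt.comp _ hFp).comp p prodPlane.hasFDerivAt
  have hsum p : D' 0 p (1, 0) + D' 1 p (0, 1) =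
      ∑ i, D i (prodPlane p) (EuclideanSpace.single i 1) := by
    have h0 : prodPlane (1, 0) = EuclideanSpace.single 0 1 := by ext i; fin_cases i <;> rfl
    have h1 : prodPlane (0, 1) = EuclideanSpace.single 1 1 := by ext i; fin_cases i <;> rfl
    simp [D', Fin.sum_univ_two, h0, h1]
  have hD : ContinuousOn (fun ξ => ∑ i, D i ξ (EuclideanSpace.single i 1)) (periodBox a b) :=
    continuousOn_finsetSum _ fun i _ => (continuousOn_const.clm_comp
      (hF.continuousOn_fderivWithin (uniqueDiffOn_periodBox hab) le_rfl)).clm_apply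
        continuousOn_const
  have key := integral_divergence_prod_Icc_of_hasFDerivAt_of_le _ _ (D' 0) (D' 1) (a, 0) (b, 1)
    (by simp [Prod.le_def, hab.le]) (hcont 0) (hcont 1) (hderiv 0) (hderiv 1) (by
      simp_rw [hsum]
      exact (hD.comp prodPlane.continuous.continuousOn hmaps).integrableOn_compact isCompact_Icc)
  simp_rw [hsum] at key
  have hchange := measurePreserving_prodPlane.setIntegral_preimage_emb
    prodPlane.toHomeomorph.measurableEmbedding
    (fun ξ => ∑ i, D i ξ (EuclideanSpace.single i 1)) (periodBox a b)
  rw [preimage_prodPlane_periodBox, key] at hchange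
  refine hchange.symm.trans ?_
  simp only [outwardFlux, verticalMean, prodPlane_apply]
  ring

lemma setIntegral_divergence_periodBox (hab : a < b) {F : Plane → Plane}
    (hF : ContDiffOn ℝ 1 F (periodBox a b)) :
    ∫ ξ in periodBox a b, divergence F ξ = outwardFlux a b F := by
  rw [← setIntegral_sum_fderivWithin_periodBox hab hF]
  refine integral_congr_ae ((ae_restrict_periodBox_mem_interior a b).mono fun ξ hξ => ?_)
  simp only [divergence_eq_sum_single, fderivWithin_of_mem_nhds (mem_interior_iff_mem_nhds.1 hξ)]

lemma fderiv_coord_sub (i : Fin 2) (c : ℝ) (ξ v : Plane) :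
    fderiv ℝ (fun η : Plane => η i - c) ξ v = v i :=
  DFunLike.congr_fun ((EuclideanSpace.proj (𝕜 := ℝ) i).hasFDerivAt.sub_const c).fderiv v

lemma divergence_coord_smul_gradientWithin_sub {Ω : Set Plane} {u : Plane → ℝ}
    (hu : ContDiffOn ℝ 2 u Ω) {ξ : Plane} (hξ : Ω ∈ 𝓝 ξ) (c : ℝ) :
    divergence (fun η => (η 0 - c) • gradientWithin u Ω η + u η • -EuclideanSpace.single 0 1) ξ =
      (ξ 0 - c) * Δ u ξ := by
  obtain ⟨S, hSΩ, hS, hξS⟩ := mem_nhds_iff.1 hξ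
  have hcoord : DifferentiableAt ℝ (fun η : Plane => η 0 - c) ξ := by fun_prop
  have hgrad : DifferentiableAt ℝ (gradientWithin u Ω) ξ :=
    ((contDiffOn_gradientWithin hS.uniqueDiffOn hSΩ hu).contDiffAt
      (hS.mem_nhds hξS)).differentiableAt one_ne_zero
  have huξ : DifferentiableAt ℝ u ξ := (hu.contDiffAt hξ).differentiableAt two_ne_zero
  rw [divergence_add (F := fun η => (η 0 - c) • gradientWithin u Ω η)
      (H := fun η => u η • -EuclideanSpace.single 0 1) (hcoord.smul hgrad)
      (huξ.smul (differentiableAt_const _)), divergence_smul hcoord hgrad,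
    divergence_smul huξ (differentiableAt_const _), divergence_const,
    divergence_gradientWithin hξ hu, fderiv_coord_sub, gradientWithin_apply, partialIn,
    fderivWithin_of_mem_nhds hξ, map_neg]
  ring

lemma continuousOn_partialIn {S Ω : Set Plane} (hS : UniqueDiffOn ℝ S) (hSΩ : S ⊆ Ω)
    {u : Plane → ℝ} (hu : ContDiffOn ℝ 2 u Ω) (i : Fin 2) : ContinuousOn (partialIn Ω u i) S := by
  simp_rw [funext fun ξ => (gradientWithin_apply u Ω ξ i).symm]
  exact (EuclideanSpace.proj (𝕜 := ℝ) i).continuous.comp_continuousOn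
    (contDiffOn_gradientWithin hS hSΩ hu).continuousOn

/-- Integrating `div ((ξ₁ - c) ∇u - u e₁) = (ξ₁ - c) Δu` over the rectangle relates the fluxes
through its vertical sides with the mean values over them. -/
lemma flux_identity_of_laplacian_eq_zero (hab : a < b) {Ω : Set Plane} (hΩ : periodBox a b ⊆ Ω)
    {u : Plane → ℝ} (hu : ContDiffOn ℝ 2 u Ω) (hΔ : ∀ ξ ∈ interior (periodBox a b), Δ u ξ = 0)
    (hper : ∀ x ∈ Icc a b, partialIn Ω u 1 !₂[x, 1] = partialIn Ω u 1 !₂[x, 0]) (c : ℝ) :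
    (b - c) * verticalMean (partialIn Ω u 0) b - (a - c) * verticalMean (partialIn Ω u 0) a =
      verticalMean u b - verticalMean u a := by
  let F : Plane → Plane := fun ξ =>
    (ξ 0 - c) • gradientWithin u Ω ξ + u ξ • -EuclideanSpace.single 0 1
  have hbox := uniqueDiffOn_periodBox hab
  have hu1 : ContDiffOn ℝ 1 u (periodBox a b) := (hu.mono hΩ).of_le (by norm_num)
  have hcoord : ContDiff ℝ 1 fun ξ : Plane => ξ 0 - c := by fun_prop
  have hF : ContDiffOn ℝ 1 F (periodBox a b) :=
    (hcoord.contDiffOn.smul (contDiffOn_gradientWithin hbox hΩ hu)).add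
      (hu1.smul contDiffOn_const)
  have hF0 ξ : F ξ 0 = (ξ 0 - c) * partialIn Ω u 0 ξ - u ξ := by
    simp [F, gradientWithin_apply, sub_eq_add_neg]
  have hF1 ξ : F ξ 1 = (ξ 0 - c) * partialIn Ω u 1 ξ := by simp [F, gradientWithin_apply]
  have hmean x (hx : x ∈ Icc a b) : verticalMean (fun ξ => F ξ 0) x =
      (x - c) * verticalMean (partialIn Ω u 0) x - verticalMean u x := by
    have hside : ∀ y ∈ Icc (0 : ℝ) 1, !₂[x, y] ∈ periodBox a b := fun y hy => ⟨hx, hy⟩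
    simp_rw [verticalMean, hF0]
    rw [← intervalIntegral.integral_const_mul, ← intervalIntegral.integral_sub
      ((intervalIntegrable_vertical (continuousOn_partialIn hbox hΩ hu 0) hside).const_mul _)
      (intervalIntegrable_vertical hu1.continuousOn hside)]
    rfl
  have hzero : outwardFlux a b F = 0 := by
    rw [← setIntegral_divergence_periodBox hab hF]
    refine integral_eq_zero_of_ae ((ae_restrict_periodBox_mem_interior a b).mono fun ξ hξ => ?_)
    rw [divergence_coord_smul_gradientWithin_sub hu
      (mem_of_superset (mem_interior_iff_mem_nhds.1 hξ) hΩ), hΔ ξ hξ, mul_zero, Pi.zero_apply]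
  rw [outwardFlux_of_periodic hab.le fun x hx => by simp [hF1, hper x hx],
    hmean b ⟨hab.le, le_rfl⟩, hmean a ⟨le_rfl, hab.le⟩] at hzero
  linarith

end Box

section RegularBoundary

variable {E : Type*} [NormedAddCommGroup E] [NormedSpace ℝ E] {φ : E → ℝ} {x v : E} {A : Set E}

lemma tendsto_add_smul_nhdsGT (x v : E) :
    Tendsto (fun t : ℝ => x + t • v) (𝓝[>] 0) (𝓝 x) := by
  have : Continuous fun t : ℝ => x + t • v := by fun_prop
  simpa using (this.tendsto 0).mono_left nhdsWithin_le_nhds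

lemma eventually_pos_of_fderiv_pos (hφ : DifferentiableAt ℝ φ x) (hx : φ x = 0)
    (hv : 0 < fderiv ℝ φ x v) : ∀ᶠ t : ℝ in 𝓝[>] 0, 0 < φ (x + t • v) := by
  have hslope := hφ.hasFDerivAt.hasLineDerivAt v |>.tendsto_slope_zero_right
  filter_upwards [hslope.eventually_const_lt hv, self_mem_nhdsWithin] with t ht ht0
  rw [hx, sub_zero, smul_eq_mul] at ht
  exact (pos_iff_pos_of_mul_pos ht).1 (inv_pos.2 ht0)

lemma eventually_add_smul_mem (hφ : DifferentiableAt ℝ φ x) (hx : φ x = 0)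
    (hA : ∀ᶠ y in 𝓝 x, 0 < φ y → y ∈ A) (hv : 0 < fderiv ℝ φ x v) :
    ∀ᶠ t : ℝ in 𝓝[>] 0, x + t • v ∈ A :=
  ((tendsto_add_smul_nhdsGT x v).eventually hA).mp
    ((eventually_pos_of_fderiv_pos hφ hx hv).mono fun _ hpos hmem => hmem hpos)

lemma mem_closure_of_eventually_pos_mem (hφ : DifferentiableAt ℝ φ x) (hx : φ x = 0)
    (hd : fderiv ℝ φ x ≠ 0) (hA : ∀ᶠ y in 𝓝 x, 0 < φ y → y ∈ A) : x ∈ closure A := by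
  obtain ⟨e, he⟩ := exists_fderiv_pos hd
  exact mem_closure_of_tendsto (tendsto_add_smul_nhdsGT x e)
    (eventually_add_smul_mem hφ hx hA he)

lemma uniqueDiffWithinAt_of_eventually_pos_mem (hφ : DifferentiableAt ℝ φ x) (hx : φ x = 0)
    (hd : fderiv ℝ φ x ≠ 0) (hA : ∀ᶠ y in 𝓝 x, 0 < φ y → y ∈ A) :
    UniqueDiffWithinAt ℝ A x := by
  obtain ⟨e, he⟩ := exists_fderiv_pos hd
  have hcone {v} (hv : 0 < fderiv ℝ φ x v) : v ∈ Submodule.span ℝ (tangentConeAt ℝ A x) :=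
    Submodule.subset_span (mem_tangentConeAt_of_add_smul_mem
      (tendsto_id'.2 (nhdsGT_le_nhdsNE 0)) (eventually_add_smul_mem hφ hx hA hv))
  refine (uniqueDiffWithinAt_iff ..).2 ⟨?_, mem_closure_of_eventually_pos_mem hφ hx hd hA⟩
  suffices Submodule.span ℝ (tangentConeAt ℝ A x) = ⊤ by
    rw [this]
    exact dense_univ
  refine Submodule.eq_top_iff'.2 fun w => ?_
  obtain ⟨c, hc⟩ := exists_gt (-fderiv ℝ φ x w / fderiv ℝ φ x e)
  have hwc : 0 < fderiv ℝ φ x (w + c • e) := by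
    rw [div_lt_iff₀ he] at hc
    simp only [map_add, map_smul, smul_eq_mul]
    linarith
  simpa using Submodule.sub_mem _ (hcone hwc) (Submodule.smul_mem _ c (hcone he))

end RegularBoundary

namespace IsLocalDefiningFunction

variable {D : Set Plane} {x : Plane} {φ : Plane → ℝ}

lemma differentiable (h : IsLocalDefiningFunction D x φ) : Differentiable ℝ φ :=
  h.smooth.differentiable (by simp)

lemma contDiff_one (h : IsLocalDefiningFunction D x φ) : ContDiff ℝ 1 φ :=
  h.smooth.of_le (by norm_cast)

lemma fderiv_ne (h : IsLocalDefiningFunction D x φ) : fderiv ℝ φ x ≠ 0 := by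
  simpa [gradient] using h.gradient_ne

lemma notMem (h : IsLocalDefiningFunction D x φ) : x ∉ D := fun hx =>
  (h.mem_iff.self_of_nhds.1 hx).ne h.zero

lemma mem_closure (h : IsLocalDefiningFunction D x φ) : x ∈ closure D :=
  mem_closure_of_eventually_pos_mem (φ := -φ) h.differentiable.neg.differentiableAt
    (by simp [h.zero]) (by rw [fderiv_neg, neg_ne_zero]; exact h.fderiv_ne)
    (h.mem_iff.mono fun _ hy hpos => hy.2 (neg_pos.1 hpos))

lemma mem_frontier (h : IsLocalDefiningFunction D x φ) : x ∈ frontier D :=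
  ⟨h.mem_closure, fun hx => h.notMem (interior_subset hx)⟩

lemma eventually_self (h : IsLocalDefiningFunction D x φ) :
    ∀ᶠ y in 𝓝 x, φ y = 0 → IsLocalDefiningFunction D y φ := by
  have hne : ∀ᶠ y in 𝓝 x, fderiv ℝ φ y ≠ 0 :=
    (h.contDiff_one.continuous_fderiv one_ne_zero).continuousAt.eventually_ne h.fderiv_ne
  filter_upwards [hne, eventually_eventually_nhds.2 h.mem_iff] with y hy hmem h0
  exact ⟨h.smooth, h0, by simpa [gradient] using hy, hmem⟩

lemma eventually_notMem_closure_iff (h : IsLocalDefiningFunction D x φ) :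
    ∀ᶠ y in 𝓝 x, y ∉ closure D ↔ 0 < φ y := by
  filter_upwards [h.eventually_self, eventually_eventually_nhds.2 h.mem_iff] with y hself hmem
  refine ⟨fun hy => ?_, fun hpos hy => mem_closure_iff_frequently.1 hy ?_⟩
  · by_contra! hle
    rcases hle.lt_or_eq with hneg | hzero
    · exact hy (subset_closure (hmem.self_of_nhds.2 hneg))
    · exact hy (hself hzero).mem_closure
  · filter_upwards [hmem, h.smooth.continuous.continuousAt.eventually_const_lt hpos] with z hz hzpos
    rw [hz]
    exact hzpos.not_gt

lemma uniqueDiffWithinAt (h : IsLocalDefiningFunction D x φ) {A : Set Plane} (hA : A ∈ 𝓝 x) :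
    UniqueDiffWithinAt ℝ (A \ D) x :=
  uniqueDiffWithinAt_of_eventually_pos_mem h.differentiable.differentiableAt h.zero h.fderiv_ne
    ((h.mem_iff.and hA).mono fun _ hy hpos => ⟨hy.2, fun hD => hpos.not_gt (hy.1.1 hD)⟩)

lemma congr_set (h : IsLocalDefiningFunction D x φ) {D' : Set Plane} (hD : D' =ᶠ[𝓝 x] D) :
    IsLocalDefiningFunction D' x φ :=
  ⟨h.smooth, h.zero, h.gradient_ne, (hD.mem_iff.and h.mem_iff).mono fun _ hy => hy.1.trans hy.2⟩

end IsLocalDefiningFunction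

section Hole

/-- An open subset of the open unit square, with closure in the square and smooth boundary: the
notion of a hole (or union of holes) for which the divergence theorem on the cell is proved. -/
structure IsRegularHole (G : Set Plane) : Prop where
  isOpen : IsOpen G
  closure_subset : closure G ⊆ openSquare
  exists_defining : ∀ x ∈ frontier G, ∃ φ, IsLocalDefiningFunction G x φ

lemma iUnion_eventuallyEq_of_disjoint_closure {X ι : Type*} [TopologicalSpace X] [Finite ι]
    {G : ι → Set X} (hG : Pairwise fun i j => Disjoint (closure (G i)) (closure (G j))) {i : ι}
    {x : X} (hx : x ∈ closure (G i)) : (⋃ j, G j) =ᶠ[𝓝 x] G i := by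
  have hfar : ∀ᶠ y in 𝓝 x, ∀ j, j ≠ i → y ∉ G j := by
    refine eventually_all.2 fun j => ?_
    by_cases hji : j = i
    · exact Eventually.of_forall fun _ h => absurd hji h
    · filter_upwards [isClosed_closure.isOpen_compl.mem_nhds ((hG hji).notMem_of_mem_right hx)]
        with y hy _ hyj using hy (subset_closure hyj)
  refine eventuallyEq_set.2 (hfar.mono fun y hy => mem_iUnion.trans ⟨?_, fun hyi => ⟨i, hyi⟩⟩)
  rintro ⟨j, hyj⟩
  by_contra hyi
  exact hy j (fun hji => hyi (hji ▸ hyj)) hyj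

lemma IsHoleSet.isRegularHole {G₀ : Set Plane} (h : IsHoleSet G₀) : IsRegularHole G₀ := by
  obtain ⟨⟨n, G, rfl, hG, hsub, hdisj⟩, -⟩ := h
  have hopen : IsOpen (⋃ i, G i) := isOpen_iUnion fun i => (hG i).isOpen
  have hclosure : closure (⋃ i, G i) = ⋃ i, closure (G i) := closure_iUnion_of_finite G
  refine ⟨hopen, hclosure ▸ iUnion_subset hsub, fun x hx => ?_⟩
  rw [hopen.frontier_eq, hclosure] at hx
  obtain ⟨i, hi⟩ := mem_iUnion.1 hx.1
  obtain ⟨φ, hφ⟩ := (hG i).smooth_boundary x (by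
    rw [(hG i).isOpen.frontier_eq]
    exact ⟨hi, fun h => hx.2 (mem_iUnion.2 ⟨i, h⟩)⟩)
  exact ⟨φ, hφ.congr_set (iUnion_eventuallyEq_of_disjoint_closure hdisj hi)⟩

lemma closedSquare_eq_periodBox : closedSquare = periodBox 0 1 := by
  ext ξ
  simp only [closedSquare, periodBox, mem_ofPred_eq, Fin.forall_fin_two]

lemma openSquare_eq_interior : openSquare = interior (periodBox 0 1) := by
  ext ξ
  simp only [openSquare, interior_periodBox, mem_ofPred_eq, Fin.forall_fin_two]

lemma isOpen_openSquare : IsOpen openSquare := openSquare_eq_interior ▸ isOpen_interior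

lemma openSquare_subset_closedSquare : openSquare ⊆ closedSquare :=
  fun _ h i => Ioo_subset_Icc_self (h i)

/-- The perforated closed unit square with the boundaries of the holes included. -/
def perfSquare (G : Set Plane) : Set Plane := closedSquare \ G

/-- The interior of the periodicity cell `cellY G`. -/
def openCell (G : Set Plane) : Set Plane := openSquare \ closure G

lemma isOpen_openCell (G : Set Plane) : IsOpen (openCell G) :=
  isOpen_openSquare.sdiff isClosed_closure

lemma openCell_subset_perfSquare (G : Set Plane) : openCell G ⊆ perfSquare G :=
  sdiff_subset_sdiff openSquare_subset_closedSquare subset_closure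

lemma openCell_ae_eq_cellY (G : Set Plane) : openCell G =ᵐ[volume] cellY G := by
  refine ae_eq_set_sdiff ?_ EventuallyEq.rfl
  rw [openSquare_eq_interior, closedSquare_eq_periodBox]
  exact interior_ae_eq_of_null_frontier ((convex_periodBox 0 1).addHaar_frontier volume)

namespace IsRegularHole

variable {G : Set Plane}

lemma uniqueDiffOn_perfSquare (hG : IsRegularHole G) : UniqueDiffOn ℝ (perfSquare G) := by
  intro x hx
  by_cases hxG : x ∈ closure G
  · obtain ⟨φ, hφ⟩ := hG.exists_defining x (by rw [hG.isOpen.frontier_eq]; exact ⟨hxG, hx.2⟩)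
    exact hφ.uniqueDiffWithinAt (mem_of_superset
      (isOpen_openSquare.mem_nhds (hG.closure_subset hxG)) openSquare_subset_closedSquare)
  · have hsquare : UniqueDiffWithinAt ℝ closedSquare x := by
      rw [closedSquare_eq_periodBox]
      exact uniqueDiffOn_periodBox one_pos x (closedSquare_eq_periodBox ▸ hx.1)
    exact (hsquare.inter (isClosed_closure.isOpen_compl.mem_nhds hxG)).mono
      fun y hy => ⟨hy.1, fun h => hy.2 (subset_closure h)⟩

lemma isCompact_perfSquare (hG : IsRegularHole G) : IsCompact (perfSquare G) :=
  (closedSquare_eq_periodBox ▸ isCompact_periodBox 0 1 : IsCompact closedSquare).diff hG.isOpen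

end IsRegularHole

end Hole

section Solenoidal

lemma exists_contDiff_eventuallyEq_one {E : Type*} [NormedAddCommGroup E] [NormedSpace ℝ E]
    [FiniteDimensional ℝ E] {K U : Set E} (hK : IsClosed K) (hU : IsOpen U) (hKU : K ⊆ U) :
    ∃ κ : E → ℝ, ContDiff ℝ ∞ κ ∧ tsupport κ ⊆ U ∧ ∀ x ∈ K, κ =ᶠ[𝓝 x] 1 := by
  obtain ⟨κ, h0, h1, -⟩ := exists_contMDiffMap_zero_one_nhds_of_isClosed 𝓘(ℝ, E) (n := ⊤)
    hU.isClosed_compl hK (disjoint_compl_left_iff_subset.2 hKU)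
  refine ⟨κ, κ.contMDiff.contDiff, fun x hx => ?_, fun x hx => h1.filter_mono (nhds_le_nhdsSet hx)⟩
  by_contra hxU
  exact notMem_tsupport_iff_eventuallyEq.2 (h0.filter_mono (nhds_le_nhdsSet hxU)) hx

lemma outwardFlux_congr {F H : Plane → Plane} (h : ∀ ξ ∉ openSquare, F ξ = H ξ) :
    outwardFlux 0 1 F = outwardFlux 0 1 H := by
  have hleft (y : ℝ) : F !₂[0, y] = H !₂[0, y] := h _ fun hmem => by simpa using (hmem 0).1
  have hright (y : ℝ) : F !₂[1, y] = H !₂[1, y] := h _ fun hmem => by simpa using (hmem 0).2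
  have hbot (x : ℝ) : F !₂[x, 0] = H !₂[x, 0] := h _ fun hmem => by simpa using (hmem 1).1
  have htop (x : ℝ) : F !₂[x, 1] = H !₂[x, 1] := h _ fun hmem => by simpa using (hmem 1).2
  simp only [outwardFlux, verticalMean, hleft, hright, hbot, htop]

variable {G : Set Plane}

/-- A vector field of class `C¹` up to the boundary of the perforated square that is divergence-free
and tangential to the boundaries of the holes. -/
structure IsSolenoidal (G : Set Plane) (F : Plane → Plane) : Prop where
  contDiffOn : ContDiffOn ℝ 1 F (perfSquare G)
  divergence_eq_zero : ∀ ξ ∈ openCell G, divergence F ξ = 0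
  tangential : ∀ ξ φ, IsLocalDefiningFunction G ξ φ → fderiv ℝ φ ξ (F ξ) = 0

namespace IsSolenoidal

variable {F : Plane → Plane} {ψ : Plane → ℝ}

lemma integrableOn_fderiv_apply (hF : IsSolenoidal G F) (hG : IsRegularHole G)
    (hψ : ContDiff ℝ 1 ψ) : IntegrableOn (fun ξ => fderiv ℝ ψ ξ (F ξ)) (openCell G) :=
  (((hψ.continuous_fderiv one_ne_zero).continuousOn.clm_apply
    hF.contDiffOn.continuousOn).integrableOn_compact hG.isCompact_perfSquare).mono_set
      (openCell_subset_perfSquare G)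

lemma exists_abs_fderiv_apply_le (hF : IsSolenoidal G F) (hG : IsRegularHole G) {x : Plane}
    (hx : x ∈ openSquare) {φ : Plane → ℝ} (hφ : IsLocalDefiningFunction G x φ) :
    ∃ C, ∀ᶠ y in 𝓝 x, 0 < φ y → |fderiv ℝ φ y (F y)| ≤ C * φ y := by
  refine exists_abs_le_mul_of_eq_zero hG.uniqueDiffOn_perfSquare hφ.contDiff_one
    ⟨openSquare_subset_closedSquare hx, hφ.notMem⟩ hφ.zero hφ.fderiv_ne ?_
    ((hφ.smooth.fderiv_right (m := 1) (by norm_cast)).contDiffOn.clm_apply hF.contDiffOn)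
    (hφ.eventually_self.mono fun y hy h0 => hF.tangential y φ (hy h0))
  filter_upwards [isOpen_openSquare.mem_nhds hx, hφ.mem_iff] with y hy hmem hnonneg
  exact ⟨openSquare_subset_closedSquare hy, fun h => (hmem.1 h).not_ge hnonneg⟩

lemma exists_mem_nhds_forall_setIntegral_eq_zero (hF : IsSolenoidal G F) (hG : IsRegularHole G)
    {x : Plane} (hx : x ∈ openSquare) : ∃ W ∈ 𝓝 x, ∀ ψ : Plane → ℝ, ContDiff ℝ ∞ ψ →
      HasCompactSupport ψ → tsupport ψ ⊆ W → ∫ ξ in openCell G, fderiv ℝ ψ ξ (F ξ) = 0 := by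
  have hFU := hF.contDiffOn.mono (openCell_subset_perfSquare G)
  by_cases hxc : x ∈ closure G
  · by_cases hxG : x ∈ G
    · refine ⟨G, hG.isOpen.mem_nhds hxG, fun ψ _ _ hψG =>
        setIntegral_eq_zero_of_forall_eq_zero fun ξ hξ => ?_⟩
      have hψξ := notMem_tsupport_iff_eventuallyEq.1 fun h => hξ.2 (subset_closure (hψG h))
      rw [hψξ.fderiv_eq]
      simp
    · obtain ⟨φ, hφ⟩ := hG.exists_defining x (by rw [hG.isOpen.frontier_eq]; exact ⟨hxc, hxG⟩)
      obtain ⟨C, hC⟩ := hF.exists_abs_fderiv_apply_le hG hx hφ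
      have hmem : ∀ᶠ y in 𝓝 x, y ∈ openCell G ↔ 0 < φ y := by
        filter_upwards [isOpen_openSquare.mem_nhds hx, hφ.eventually_notMem_closure_iff]
          with y hy hiff
        exact (and_iff_right hy).trans hiff
      refine ⟨_, hmem.and hC, fun ψ hψ hψc hψW => ?_⟩
      have hψ1 : ContDiff ℝ 1 ψ := hψ.of_le (by norm_cast)
      exact setIntegral_fderiv_apply_eq_zero_of_tangential (isOpen_openCell G) hFU
        hF.divergence_eq_zero hφ.contDiff_one hψ1 hψc (fun y hy => (hψW hy).1)
        (fun y hy => (hψW hy).2) (hF.integrableOn_fderiv_apply hG hψ1)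
  · exact ⟨openCell G, (isOpen_openCell G).mem_nhds ⟨hx, hxc⟩, fun ψ hψ hψc hψU =>
      setIntegral_fderiv_apply_eq_zero (isOpen_openCell G) hFU hF.divergence_eq_zero
        (hψ.of_le (by norm_cast)) hψc hψU⟩

lemma setIntegral_fderiv_apply_eq_zero_of_tsupport_subset (hF : IsSolenoidal G F)
    (hG : IsRegularHole G) (hψ : ContDiff ℝ ∞ ψ) (hψs : tsupport ψ ⊆ openSquare) :
    ∫ ξ in openCell G, fderiv ℝ ψ ξ (F ξ) = 0 := by
  have hc : HasCompactSupport ψ := (closedSquare_eq_periodBox ▸ isCompact_periodBox 0 1 :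
    IsCompact closedSquare).of_isClosed_subset (isClosed_tsupport ψ)
      (hψs.trans openSquare_subset_closedSquare)
  exact setIntegral_fderiv_apply_eq_zero_of_locally hψ hc
    (fun f hf => hF.integrableOn_fderiv_apply hG (hf.of_le (by norm_cast)))
    fun x hx => hF.exists_mem_nhds_forall_setIntegral_eq_zero hG (hψs hx)

lemma contDiffOn_smul_of_eventuallyEq_zero (hF : IsSolenoidal G F) (hψ : ContDiff ℝ 1 ψ)
    (hψ0 : ∀ ξ ∈ closure G, ψ =ᶠ[𝓝 ξ] 0) :
    ContDiffOn ℝ 1 (fun ξ => ψ ξ • F ξ) (periodBox 0 1) := by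
  rw [← closedSquare_eq_periodBox]
  intro ξ hξ
  by_cases hξG : ξ ∈ closure G
  · refine (contDiffAt_const (c := 0)).congr_of_eventuallyEq ?_ |>.contDiffWithinAt
    exact (hψ0 ξ hξG).mono fun η hη => by simp [hη]
  · refine hψ.contDiffAt.contDiffWithinAt.smul
      ((hF.contDiffOn ξ ⟨hξ, fun h => hξG (subset_closure h)⟩).mono_of_mem_nhdsWithin ?_)
    filter_upwards [self_mem_nhdsWithin,
      mem_nhdsWithin_of_mem_nhds (isClosed_closure.isOpen_compl.mem_nhds hξG)] with η hη hηG
    exact ⟨hη, fun h => hηG (subset_closure h)⟩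

lemma setIntegral_fderiv_apply_of_eventuallyEq_zero (hF : IsSolenoidal G F)
    (hψ : ContDiff ℝ 1 ψ) (hψ0 : ∀ ξ ∈ closure G, ψ =ᶠ[𝓝 ξ] 0) :
    ∫ ξ in openCell G, fderiv ℝ ψ ξ (F ξ) = outwardFlux 0 1 fun ξ => ψ ξ • F ξ := by
  have hsquare : openSquare =ᵐ[volume] periodBox 0 1 := by
    rw [openSquare_eq_interior]
    exact interior_ae_eq_of_null_frontier ((convex_periodBox 0 1).addHaar_frontier volume)
  rw [← setIntegral_divergence_periodBox one_pos (hF.contDiffOn_smul_of_eventuallyEq_zero hψ hψ0),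
    ← setIntegral_congr_set hsquare, setIntegral_eq_of_subset_of_forall_sdiff_eq_zero
      isOpen_openSquare.measurableSet (s := openCell G) sdiff_subset]
  · refine setIntegral_congr_fun (isOpen_openCell G).measurableSet fun ξ hξ => ?_
    have hFξ := (hF.contDiffOn.mono (openCell_subset_perfSquare G)).contDiffAt
      ((isOpen_openCell G).mem_nhds hξ)
    rw [divergence_smul (hψ.differentiable one_ne_zero ξ) (hFξ.differentiableAt one_ne_zero),
      hF.divergence_eq_zero ξ hξ, mul_zero, zero_add]
  · intro ξ hξ
    have hξG : ξ ∈ closure G := by_contra fun h => hξ.2 ⟨hξ.1, h⟩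
    have h0 : (fun η => ψ η • F η) =ᶠ[𝓝 ξ] fun _ => 0 :=
      (hψ0 ξ hξG).mono fun η hη => by simp [hη]
    rw [divergence, h0.fderiv_eq]
    simp

lemma setIntegral_fderiv_apply (hF : IsSolenoidal G F) (hG : IsRegularHole G)
    (hψ : ContDiff ℝ ∞ ψ) :
    ∫ ξ in cellY G, fderiv ℝ ψ ξ (F ξ) = outwardFlux 0 1 fun ξ => ψ ξ • F ξ := by
  obtain ⟨κ, hκ, hκs, hκ1⟩ :=
    exists_contDiff_eventuallyEq_one isClosed_closure isOpen_openSquare hG.closure_subset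
  have hinner : ContDiff ℝ ∞ fun ξ => κ ξ * ψ ξ := hκ.mul hψ
  have houter : ContDiff ℝ 1 fun ξ => (1 - κ ξ) * ψ ξ :=
    ((contDiff_const.sub hκ).mul hψ).of_le (by norm_cast)
  have hinner1 : ContDiff ℝ 1 fun ξ => κ ξ * ψ ξ := hinner.of_le (by norm_cast)
  have hsplit ξ : fderiv ℝ ψ ξ (F ξ) = fderiv ℝ (fun ξ => κ ξ * ψ ξ) ξ (F ξ) +
      fderiv ℝ (fun ξ => (1 - κ ξ) * ψ ξ) ξ (F ξ) := by
    rw [← add_apply, ← fderiv_fun_add (hinner1.differentiable one_ne_zero ξ)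
      (houter.differentiable one_ne_zero ξ)]
    simp [← add_mul]
  rw [← setIntegral_congr_set (openCell_ae_eq_cellY G)]
  simp_rw [hsplit]
  rw [integral_add (hF.integrableOn_fderiv_apply hG hinner1)
      (hF.integrableOn_fderiv_apply hG houter),
    hF.setIntegral_fderiv_apply_eq_zero_of_tsupport_subset hG hinner
      (tsupport_mul_subset_left.trans hκs), zero_add,
    hF.setIntegral_fderiv_apply_of_eventuallyEq_zero houter fun ξ hξ =>
      (hκ1 ξ hξ).mono fun η hη => by simp [hη]]
  refine outwardFlux_congr fun ξ hξ => ?_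
  rw [image_eq_zero_of_notMem_tsupport fun h => hξ (hκs h), sub_zero, one_mul]

lemma verticalMean_one_eq_verticalMean_zero (hF : IsSolenoidal G F) (hG : IsRegularHole G)
    (hper : ∀ x ∈ Icc (0 : ℝ) 1, F !₂[x, 1] 1 = F !₂[x, 0] 1) :
    verticalMean (fun ξ => F ξ 0) 1 = verticalMean (fun ξ => F ξ 0) 0 := by
  have hgreen := hF.setIntegral_fderiv_apply hG (contDiff_const (c := (1 : ℝ)))
  simp only [fderiv_fun_const, one_smul, outwardFlux_of_periodic zero_le_one hper] at hgreen
  simpa [sub_eq_zero] using hgreen.symm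

lemma setIntegral_apply_zero (hF : IsSolenoidal G F) (hG : IsRegularHole G)
    (hper : ∀ x ∈ Icc (0 : ℝ) 1, F !₂[x, 1] 1 = F !₂[x, 0] 1) :
    ∫ ξ in cellY G, F ξ 0 = verticalMean (fun ξ => F ξ 0) 1 := by
  have hgreen := hF.setIntegral_fderiv_apply hG (ψ := fun ξ => ξ 0 - 0) (by fun_prop)
  simp_rw [fderiv_coord_sub] at hgreen
  rw [hgreen, outwardFlux_of_periodic zero_le_one fun x hx => by simp [hper x hx]]
  simp [verticalMean]

end IsSolenoidal

end Solenoidal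

section Lattice

lemma latticePoint_zero : latticePoint 0 = 0 := by
  ext i
  simp [latticePoint]

lemma latticePoint_sub (k l : Fin 2 → ℤ) :
    latticePoint (k - l) = latticePoint k - latticePoint l := by
  ext i
  simp [latticePoint]

lemma vec_zero_add_latticePoint (x : ℝ) :
    (!₂[x, 0] : Plane) + latticePoint ![0, 1] = !₂[x, 1] := by
  ext i
  fin_cases i <;> simp [latticePoint]

lemma vec_add_latticePoint (x y : ℝ) (n : ℤ) :
    (!₂[x, y] : Plane) + latticePoint ![n, 0] = !₂[x + n, y] := by
  ext i
  fin_cases i <;> simp [latticePoint]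

lemma add_latticePoint_mem_perfPlane_iff {G : Set Plane} (k : Fin 2 → ℤ) (ξ : Plane) :
    ξ + latticePoint k ∈ perfPlane G ↔ ξ ∈ perfPlane G := by
  refine (Equiv.subRight k).forall_congr fun l => ?_
  rw [Equiv.subRight_apply, latticePoint_sub, sub_sub_eq_add_sub]

lemma eq_zero_of_sub_latticePoint_mem_openSquare {ξ : Plane} (hξ : ξ ∈ closedSquare)
    {k : Fin 2 → ℤ} (hk : ξ - latticePoint k ∈ openSquare) : k = 0 := by
  ext i
  obtain ⟨hlower, hupper⟩ : 0 < ξ i - k i ∧ ξ i - k i < 1 := hk i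
  have hlt : k i < 1 := by exact_mod_cast (by linarith [(hξ i).2] : (k i : ℝ) < 1)
  have hgt : -1 < k i := by exact_mod_cast (by linarith [(hξ i).1] : (-1 : ℝ) < k i)
  rw [Pi.zero_apply]
  omega

lemma mem_perfPlane_of_subset_openSquare {A : Set Plane} (hA : A ⊆ openSquare) {ξ : Plane}
    (hξ : ξ ∈ closedSquare) (hξA : ξ ∉ A) : ξ ∈ perfPlane A := by
  intro k hk
  obtain rfl := eq_zero_of_sub_latticePoint_mem_openSquare hξ (hA hk)
  exact hξA (by simpa [latticePoint_zero] using hk)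

namespace IsRegularHole

variable {G : Set Plane}

lemma perfSquare_subset_perfPlane (hG : IsRegularHole G) : perfSquare G ⊆ perfPlane G :=
  fun _ hξ => mem_perfPlane_of_subset_openSquare (subset_closure.trans hG.closure_subset) hξ.1 hξ.2

lemma openCell_subset_perfPlaneInt (hG : IsRegularHole G) : openCell G ⊆ perfPlaneInt G :=
  fun _ hξ => mem_perfPlane_of_subset_openSquare hG.closure_subset
    (openSquare_subset_closedSquare hξ.1) hξ.2

lemma mem_perfSquare_of_notMem_openSquare (hG : IsRegularHole G) {ξ : Plane}
    (hξ : ξ ∈ closedSquare) (hξo : ξ ∉ openSquare) : ξ ∈ perfSquare G :=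
  ⟨hξ, fun h => hξo (hG.closure_subset (subset_closure h))⟩

lemma left_mem_perfSquare (hG : IsRegularHole G) {t : ℝ} (ht : t ∈ Icc (0 : ℝ) 1) :
    !₂[0, t] ∈ perfSquare G :=
  hG.mem_perfSquare_of_notMem_openSquare (Fin.forall_fin_two.2 ⟨by simp, ht⟩)
    fun h => by simpa using (h 0).1

lemma bottom_mem_perfSquare (hG : IsRegularHole G) {t : ℝ} (ht : t ∈ Icc (0 : ℝ) 1) :
    !₂[t, 0] ∈ perfSquare G :=
  hG.mem_perfSquare_of_notMem_openSquare (Fin.forall_fin_two.2 ⟨ht, by simp⟩)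
    fun h => by simpa using (h 1).1

end IsRegularHole

lemma partialIn_top_eq_bottom {Ω : Set Plane} {u : Plane → ℝ}
    (hΩ : ∀ ξ, ξ + latticePoint ![0, 1] ∈ Ω ↔ ξ ∈ Ω)
    (hu : ∀ ξ ∈ Ω, u (ξ + latticePoint ![0, 1]) = u ξ) {x : ℝ} (hx : !₂[x, 0] ∈ Ω) (i : Fin 2) :
    partialIn Ω u i !₂[x, 1] = partialIn Ω u i !₂[x, 0] := by
  rw [partialIn, partialIn, ← vec_zero_add_latticePoint, fderivWithin_add_of_periodic hΩ hu hx]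

end Lattice

section CellPotential

variable {G Ω : Set Plane} {c : Plane} {u : Plane → ℝ}

/-- The function `u` on `Ω ⊇ perfSquare G` is `1`-periodic in `ξ₂`, harmonic in the cell, and
`∂_ν u = -⟨c, ν⟩` on the boundaries of the holes. The cell solution (`c = e₁`) and the integer
translates of the right layer function (`c = 0`) are of this kind. -/
structure IsCellPotential (G Ω : Set Plane) (c : Plane) (u : Plane → ℝ) : Prop where
  perfSquare_subset : perfSquare G ⊆ Ω
  add_mem_iff : ∀ ξ, ξ + latticePoint ![0, 1] ∈ Ω ↔ ξ ∈ Ω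
  contDiffOn : ContDiffOn ℝ 2 u Ω
  periodic : ∀ ξ ∈ Ω, u (ξ + latticePoint ![0, 1]) = u ξ
  laplacian_eq_zero : ∀ ξ ∈ openCell G, Δ u ξ = 0
  neumann : ∀ ξ ∈ frontier G, ∀ ν, IsUnitNormalInto G ξ ν → fderivWithin ℝ u Ω ξ ν = -⟪c, ν⟫_ℝ

namespace IsCellPotential

lemma isSolenoidal (hu : IsCellPotential G Ω c u) (hG : IsRegularHole G) :
    IsSolenoidal G fun ξ => gradientWithin u Ω ξ + c where
  contDiffOn := (contDiffOn_gradientWithin hG.uniqueDiffOn_perfSquare hu.perfSquare_subset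
    hu.contDiffOn).add contDiffOn_const
  divergence_eq_zero ξ hξ := by
    have hΩ : Ω ∈ 𝓝 ξ := mem_of_superset ((isOpen_openCell G).mem_nhds hξ)
      ((openCell_subset_perfSquare G).trans hu.perfSquare_subset)
    have hgrad : fderiv ℝ (fun η => gradientWithin u Ω η + c) ξ =
      fderiv ℝ (gradientWithin u Ω) ξ := fderiv_add_const c
    rw [divergence, hgrad, ← divergence, divergence_gradientWithin hΩ hu.contDiffOn,
      hu.laplacian_eq_zero ξ hξ]
  tangential ξ φ hφ := by
    have hnormal := hu.neumann ξ hφ.mem_frontier _ ⟨φ, hφ, rfl⟩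
    have hne : ‖∇ φ ξ‖⁻¹ ≠ 0 := inv_ne_zero (norm_ne_zero_iff.2 hφ.gradient_ne)
    rw [map_neg, map_smul, inner_neg_right, real_inner_smul_right, smul_eq_mul, neg_inj,
      ← mul_neg, mul_right_inj' hne, ← inner_gradientWithin_left] at hnormal
    rw [← inner_gradient_left, real_inner_comm, inner_add_left, hnormal, neg_add_cancel]

lemma gradientWithin_top_eq_bottom (hu : IsCellPotential G Ω c u) (hG : IsRegularHole G) :
    ∀ x ∈ Icc (0 : ℝ) 1,
      (gradientWithin u Ω !₂[x, 1] + c) 1 = (gradientWithin u Ω !₂[x, 0] + c) 1 := by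
  intro x hx
  simp only [PiLp.add_apply, gradientWithin_apply, partialIn_top_eq_bottom hu.add_mem_iff
    hu.periodic (hu.perfSquare_subset (hG.bottom_mem_perfSquare hx))]

lemma verticalMean_one_eq_verticalMean_zero (hu : IsCellPotential G Ω c u)
    (hG : IsRegularHole G) :
    verticalMean (fun ξ => partialIn Ω u 0 ξ + c 0) 1 =
      verticalMean (fun ξ => partialIn Ω u 0 ξ + c 0) 0 := by
  simpa only [PiLp.add_apply, gradientWithin_apply] using
    (hu.isSolenoidal hG).verticalMean_one_eq_verticalMean_zero hG
      (hu.gradientWithin_top_eq_bottom hG)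

lemma setIntegral_partialIn_add (hu : IsCellPotential G Ω c u) (hG : IsRegularHole G) :
    ∫ ξ in cellY G, (partialIn Ω u 0 ξ + c 0) =
      verticalMean (fun ξ => partialIn Ω u 0 ξ + c 0) 1 := by
  simpa only [PiLp.add_apply, gradientWithin_apply] using
    (hu.isSolenoidal hG).setIntegral_apply_zero hG (hu.gradientWithin_top_eq_bottom hG)

end IsCellPotential

end CellPotential

section CellSolution

variable {G : Set Plane} {N : Plane → ℝ}

lemma IsCellSolution.isCellPotential (hN : IsCellSolution G N) (hG : IsRegularHole G) :
    IsCellPotential G (perfPlane G) (EuclideanSpace.single 0 1) N where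
  perfSquare_subset := hG.perfSquare_subset_perfPlane
  add_mem_iff := add_latticePoint_mem_perfPlane_iff _
  contDiffOn := hN.smooth.of_le (by norm_cast)
  periodic := hN.periodic _
  laplacian_eq_zero ξ hξ := hN.laplace ξ (hG.openCell_subset_perfPlaneInt hξ)
  neumann ξ hξ ν hν := by
    rw [hN.neumann ξ hξ ν hν, EuclideanSpace.inner_single_left]
    simp

theorem IsCellSolution.interfaceFlux_eq (hN : IsCellSolution G N) (hG : IsRegularHole G) :
    interfaceFlux G N = volume.real (cellY G) * h11 G N := by
  have hpot := hN.isCellPotential hG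
  have hflux : verticalMean (fun ξ => partialIn (perfPlane G) N 0 ξ + 1) 1 =
      interfaceFlux G N := by
    simpa [verticalMean, interfaceFlux] using hpot.verticalMean_one_eq_verticalMean_zero hG
  have hcell : ∫ ξ in cellY G, (partialIn (perfPlane G) N 0 ξ + 1) = interfaceFlux G N := by
    simpa [hflux] using hpot.setIntegral_partialIn_add hG
  have hfin : volume (cellY G) ≠ ⊤ := measure_ne_top_of_subset sdiff_subset
    (closedSquare_eq_periodBox ▸ (isCompact_periodBox 0 1).measure_ne_top)
  rw [h11, ← smul_eq_mul, measure_smul_setAverage _ hfin, ← hcell]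
  simp_rw [add_comm]

end CellSolution

section RightHalf

lemma laplacian_comp_add (u : Plane → ℝ) (a ξ : Plane) :
    Δ (fun η => u (η + a)) ξ = Δ u (ξ + a) := by
  simp only [InnerProductSpace.laplacian_eq_iteratedFDeriv_orthonormalBasis _
    (EuclideanSpace.basisFun (Fin 2) ℝ), iteratedFDeriv_comp_add_right]

lemma verticalMean_partialIn_comp_add (Ω : Set Plane) (u : Plane → ℝ) (i : Fin 2) (n : ℤ) (x : ℝ) :
    verticalMean (partialIn {ξ | ξ + latticePoint ![n, 0] ∈ Ω}
      (fun ξ => u (ξ + latticePoint ![n, 0])) i) x = verticalMean (partialIn Ω u i) (x + n) := by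
  simp only [verticalMean, partialIn, fderivWithin_comp_add, vec_add_latticePoint]

variable {G : Set Plane}

lemma add_mem_rightHalf_iff (ξ : Plane) :
    ξ + latticePoint ![0, 1] ∈ rightHalf G ↔ ξ ∈ rightHalf G := by
  refine and_congr ?_ (add_latticePoint_mem_perfPlane_iff _ ξ)
  simp [latticePoint]

lemma add_latticePoint_mem_rightHalf {ξ : Plane} (hξ : ξ ∈ rightHalf G) (n : ℕ) :
    ξ + latticePoint ![n, 0] ∈ rightHalf G := by
  refine ⟨?_, (add_latticePoint_mem_perfPlane_iff _ ξ).2 hξ.2⟩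
  simpa [latticePoint] using add_nonneg hξ.1 n.cast_nonneg

lemma IsRegularHole.perfSquare_subset_rightHalf (hG : IsRegularHole G) :
    perfSquare G ⊆ rightHalf G :=
  fun _ hξ => ⟨(hξ.1 0).1, hG.perfSquare_subset_perfPlane hξ⟩

lemma IsRegularHole.exists_lt_coord (hG : IsRegularHole G) :
    ∃ δ : ℝ, 0 < δ ∧ ∀ ξ ∈ closure G, δ < ξ 0 := by
  have hcompact : IsCompact (closure G) :=
    (isCompact_periodBox 0 1).of_isClosed_subset isClosed_closure
      (closedSquare_eq_periodBox ▸ hG.closure_subset.trans openSquare_subset_closedSquare)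
  obtain ⟨δ, hδ, hle⟩ := hcompact.exists_forall_le' (f := fun ξ : Plane => ξ 0)
    (EuclideanSpace.proj (𝕜 := ℝ) (0 : Fin 2)).continuous.continuousOn
    (fun ξ hξ => (hG.closure_subset hξ 0).1)
  exact ⟨δ / 2, half_pos hδ, fun ξ hξ => (half_lt_self hδ).trans_le (hle ξ hξ)⟩

lemma IsRegularHole.mem_perfPlaneInt_of_coord_mem (hG : IsRegularHole G) {δ : ℝ}
    (hδ : ∀ ξ ∈ closure G, δ < ξ 0) {n : ℤ} {ξ : Plane} (hξ : ξ 0 ∈ Icc (n : ℝ) (n + δ)) :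
    ξ ∈ perfPlaneInt G := by
  intro k hk
  have hlower : δ < ξ 0 - k 0 := hδ _ hk
  have hupper : ξ 0 - k 0 < 1 := (hG.closure_subset hk 0).2
  have hlt : k 0 < n := by exact_mod_cast (by linarith [hξ.2] : (k 0 : ℝ) < n)
  have hgt : n - 1 < k 0 := by exact_mod_cast (by linarith [hξ.1] : (n - 1 : ℝ) < k 0)
  omega

end RightHalf

lemma tendsto_verticalMean_zero {ι : Type*} {l : Filter ι} {x : ι → ℝ} {u : Plane → ℝ}
    (h : ∀ ε > 0, ∀ᶠ i in l, ∀ y ∈ Icc (0 : ℝ) 1, |u !₂[x i, y]| < ε) :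
    Tendsto (fun i => verticalMean u (x i)) l (𝓝 0) := by
  refine Metric.tendsto_nhds.2 fun ε hε => (h (ε / 2) (half_pos hε)).mono fun i hi => ?_
  have hle := intervalIntegral.norm_integral_le_of_norm_le_const (a := (0 : ℝ)) (b := 1)
    (f := fun y => u !₂[x i, y]) fun y hy =>
      (hi y (Ioc_subset_Icc_self (uIoc_of_le (zero_le_one (α := ℝ)) ▸ hy))).le
  rw [dist_zero_right]
  exact (hle.trans_eq (by simp)).trans_lt (half_lt_self hε)

namespace IsInnerLayerSolution

variable {G : Set Plane} {N Bm Bp : Plane → ℝ} {J q : ℝ}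

lemma isCellPotential (hB : IsInnerLayerSolution G N J q Bm Bp) (hG : IsRegularHole G) (n : ℕ) :
    IsCellPotential G {ξ | ξ + latticePoint ![n, 0] ∈ rightHalf G} 0
      (fun ξ => Bp (ξ + latticePoint ![n, 0])) where
  perfSquare_subset ξ hξ := add_latticePoint_mem_rightHalf (hG.perfSquare_subset_rightHalf hξ) n
  add_mem_iff ξ := by
    rw [mem_ofPred_eq, add_right_comm, add_mem_rightHalf_iff, mem_ofPred_eq]
  contDiffOn := (hB.smooth_right.of_le (by norm_cast)).comp
    (contDiff_id.add contDiff_const).contDiffOn fun _ hξ => hξ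
  periodic ξ hξ := by
    rw [add_right_comm]
    exact hB.periodic_right _ hξ
  laplacian_eq_zero ξ hξ := by
    rw [laplacian_comp_add]
    refine hB.laplace_right _ ((add_latticePoint_mem_perfPlane_iff _ ξ).2
      (hG.openCell_subset_perfPlaneInt hξ)) ?_
    simpa [latticePoint] using add_pos_of_pos_of_nonneg (hξ.1 0).1 n.cast_nonneg
  neumann ξ hξ ν hν := by
    rw [fderivWithin_comp_add, hB.neumann _ (by simp) ξ hξ ν hν, inner_zero_left, neg_zero]

lemma verticalMean_partialIn_right (hB : IsInnerLayerSolution G N J q Bm Bp)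
    (hG : IsRegularHole G) (n : ℕ) :
    verticalMean (partialIn (rightHalf G) Bp 0) n =
      verticalMean (partialIn (rightHalf G) Bp 0) 0 := by
  induction n with
  | zero => rw [Nat.cast_zero]
  | succ n ih =>
    have hstep := (hB.isCellPotential hG n).verticalMean_one_eq_verticalMean_zero hG
    simp only [PiLp.zero_apply, add_zero] at hstep
    simpa [verticalMean_partialIn_comp_add, add_comm (1 : ℝ), ih] using hstep

lemma verticalMean_partialIn_right_zero (hB : IsInnerLayerSolution G N J q Bm Bp)
    (hG : IsRegularHole G) : verticalMean (partialIn (rightHalf G) Bp 0) 0 = 0 := by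
  obtain ⟨δ, hδ, hδG⟩ := hG.exists_lt_coord
  have hstrip (n : ℕ) {ξ : Plane} (hξ : ξ 0 ∈ Icc (n : ℝ) (n + δ)) : ξ ∈ perfPlaneInt G :=
    hG.mem_perfPlaneInt_of_coord_mem hδG (n := n) (by simpa using hξ)
  have hbox (n : ℕ) : periodBox n (n + δ) ⊆ rightHalf G := fun ξ hξ =>
    ⟨n.cast_nonneg.trans hξ.1.1, fun k hk => hstrip n hξ.1 k (subset_closure hk)⟩
  have hflux (n : ℕ) : δ * verticalMean (partialIn (rightHalf G) Bp 0) 0 =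
      verticalMean Bp (n + δ) - verticalMean Bp n := by
    rw [← flux_identity_of_laplacian_eq_zero (by linarith) (hbox n)
      (hB.smooth_right.of_le (by norm_cast)) (c := n + δ), hB.verticalMean_partialIn_right hG]
    · ring
    · intro ξ hξ
      rw [interior_periodBox] at hξ
      exact hB.laplace_right ξ (hstrip n (Ioo_subset_Icc_self hξ.1))
        (n.cast_nonneg.trans_lt hξ.1.1)
    · exact fun x hx => partialIn_top_eq_bottom add_mem_rightHalf_iff hB.periodic_right
        (hbox n ⟨hx, by simp⟩) 1
  have hdecay {x : ℕ → ℝ} (hx : ∀ n : ℕ, x n ∈ Icc (n : ℝ) (n + δ)) :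
      Tendsto (fun n => verticalMean Bp (x n)) atTop (𝓝 0) := by
    refine tendsto_verticalMean_zero fun ε hε => ?_
    obtain ⟨M, hM⟩ := hB.decay_right ε hε
    filter_upwards [eventually_ge_atTop ⌈M⌉₊] with n hn y hy
    exact hM _ (hbox n ⟨hx n, hy⟩) ((Nat.ceil_le.1 hn).trans (hx n).1)
  have hlim := (hdecay (x := fun n => n + δ) fun n => ⟨by linarith, le_rfl⟩).sub
    (hdecay (x := fun n => n) fun n => ⟨le_rfl, by linarith⟩)
  simp_rw [← hflux, sub_zero] at hlim
  exact (mul_eq_zero.1 (tendsto_nhds_unique tendsto_const_nhds hlim)).resolve_left hδ.ne'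

lemma verticalMean_partialIn_left_zero (hB : IsInnerLayerSolution G N J q Bm Bp) :
    verticalMean (partialIn leftHalf Bm 0) 0 = 0 := by
  have hbox (M : ℝ) : periodBox (-M) 0 ⊆ leftHalf := fun ξ hξ => hξ.1.2
  have hadd (ξ : Plane) : ξ + latticePoint ![0, 1] ∈ leftHalf ↔ ξ ∈ leftHalf := by
    simp [leftHalf, latticePoint]
  have hflux : ∀ᶠ M : ℝ in atTop, M⁻¹ * (verticalMean Bm 0 - verticalMean Bm (-M)) =
      verticalMean (partialIn leftHalf Bm 0) 0 := by
    filter_upwards [eventually_gt_atTop 0] with M hM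
    rw [← flux_identity_of_laplacian_eq_zero (by linarith) (hbox M)
      (hB.smooth_left.of_le (by norm_cast)) (c := -M)]
    · field_simp
      ring
    · intro ξ hξ
      rw [interior_periodBox] at hξ
      exact hB.laplace_left ξ hξ.1.2
    · exact fun x hx => partialIn_top_eq_bottom hadd hB.periodic_left (hbox M ⟨hx, by simp⟩) 1
  have hdecay : Tendsto (fun M : ℝ => verticalMean Bm (-M)) atTop (𝓝 0) := by
    refine tendsto_verticalMean_zero fun ε hε => ?_
    obtain ⟨M₀, hM₀⟩ := hB.decay_left ε hε
    filter_upwards [eventually_ge_atTop M₀, eventually_ge_atTop 0] with M hM hM0 y _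
    exact hM₀ _ (by simpa [leftHalf] using hM0) (by simpa using hM)
  have hlim := tendsto_inv_atTop_zero.mul (hdecay.const_sub (verticalMean Bm 0))
  rw [zero_mul] at hlim
  exact tendsto_nhds_unique (tendsto_const_nhds.congr' (hflux.mono fun _ h => h.symm)) hlim

lemma intervalIntegrable_partialIn_left (hB : IsInnerLayerSolution G N J q Bm Bp) :
    IntervalIntegrable (fun t => partialIn leftHalf Bm 0 !₂[0, t]) volume 0 1 :=
  intervalIntegrable_vertical (S := periodBox (-1) 0)
    (continuousOn_partialIn (uniqueDiffOn_periodBox (by norm_num)) (fun _ hξ => hξ.1.2)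
      (hB.smooth_left.of_le (by norm_cast)) 0) fun y hy => ⟨by simp, hy⟩

theorem flux_eq (hB : IsInnerLayerSolution G N J q Bm Bp) (hG : IsRegularHole G)
    (hN : IsCellSolution G N) : J = interfaceFlux G N := by
  have hright : IntervalIntegrable (fun t => partialIn (rightHalf G) Bp 0 !₂[0, t]) volume 0 1 :=
    intervalIntegrable_vertical (continuousOn_partialIn hG.uniqueDiffOn_perfSquare
      hG.perfSquare_subset_rightHalf (hB.smooth_right.of_le (by norm_cast)) 0)
      fun y hy => hG.left_mem_perfSquare hy
  have hcell : IntervalIntegrable (fun t => partialIn (perfPlane G) N 0 !₂[0, t] + 1)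
      volume 0 1 :=
    (intervalIntegrable_vertical (continuousOn_partialIn hG.uniqueDiffOn_perfSquare
      hG.perfSquare_subset_perfPlane (hN.smooth.of_le (by norm_cast)) 0)
      fun y hy => hG.left_mem_perfSquare hy).add intervalIntegrable_const
  calc J = ∫ _ in (0 : ℝ)..1, J := by simp
    _ = ∫ t in (0 : ℝ)..1, (partialIn (rightHalf G) Bp 0 !₂[0, t] -
          partialIn leftHalf Bm 0 !₂[0, t] + (partialIn (perfPlane G) N 0 !₂[0, t] + 1)) :=
        intervalIntegral.integral_congr_Ioo_of_le zero_le_one fun t ht => by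
          simp only [hB.jump_deriv t ht]
          ring
    _ = verticalMean (partialIn (rightHalf G) Bp 0) 0 -
          verticalMean (partialIn leftHalf Bm 0) 0 + interfaceFlux G N := by
        rw [intervalIntegral.integral_add (hright.sub hB.intervalIntegrable_partialIn_left) hcell,
          intervalIntegral.integral_sub hright hB.intervalIntegrable_partialIn_left]
        rfl
    _ = interfaceFlux G N := by
        rw [hB.verticalMean_partialIn_right_zero hG, hB.verticalMean_partialIn_left_zero, sub_self,
          zero_add]

end IsInnerLayerSolution

end

theorem proposition3p5_general (G₀ : Set Plane) (hG : IsRegularHole G₀)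
    (N₁ : Plane → ℝ) (hN₁ : IsCellSolution G₀ N₁) :
    (∀ J : ℝ, IsFluxConstant G₀ N₁ J → J = interfaceFlux G₀ N₁) ∧
    interfaceFlux G₀ N₁ = volume.real (cellY G₀) * h11 G₀ N₁ ∧
    (∀ d : ℝ, ∀ vm vp : Plane → ℝ,
      (TransmissionCondition d (interfaceFlux G₀ N₁) vm vp ↔
        TransmissionCondition d (volume.real (cellY G₀) * h11 G₀ N₁) vm vp)) := by
  have hflux := hN₁.interfaceFlux_eq hG
  refine ⟨?_, hflux, fun d vm vp => by rw [hflux]⟩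
  rintro J ⟨q, Bm, Bp, hB⟩
  exact hB.flux_eq hG hN₁

theorem proposition3p5 (G₀ : Set Plane) (hG₀ : IsHoleSet G₀)
    (N₁ : Plane → ℝ) (hN₁ : IsCellSolution G₀ N₁) :
    (∀ J : ℝ, IsFluxConstant G₀ N₁ J → J = interfaceFlux G₀ N₁) ∧
    interfaceFlux G₀ N₁ = volume.real (cellY G₀) * h11 G₀ N₁ ∧
    (∀ d : ℝ, 0 < d → ∀ vm vp : Plane → ℝ,
      (TransmissionCondition d (interfaceFlux G₀ N₁) vm vp ↔
        TransmissionCondition d (volume.real (cellY G₀) * h11 G₀ N₁) vm vp)) :=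
  have ⟨hJ, hflux, htrans⟩ := proposition3p5_general G₀ hG₀.isRegularHole N₁ hN₁
  ⟨hJ, hflux, fun d _ => htrans d⟩
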